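/- Let $V$ be a finite-dimensional real vector space. **Piecewise linear paths.** Let $\mathsf{FMon}(S)$ be the free monoid on a set $S$. $\operatorname{PL}_0(V)$ is the quotient of $\mathsf{FMon}(V)$ by the relations $(v,w)\sim(v+w)$ for linearly dependent $v,w\in V$, and $(0)\sim\emptyset$. It is a group, and every $\mathbf x\in\operatorname{PL}_0(V)$ has a unique minimal representative $(v_1,\dots,v_n)_{\min}$, i.e. a word representing $\mathbf x$ in which all $v_i\neq0$ and consecutive letters are linearly independent. The span of $\mathbf x$ is $\operatorname{span}(v_1,\dots,v_n)$. A planar loop is an element $\mathbf b$ whose letters sum to $0$ and whose span has dimension at most $2$. A kite is a pair $(\mathbf w,\mathbf b)$ with $\mathbf w\in\operatorname{PL}_0(V)$ and $\mathbf b$ a planar loop. **Piecewise linear surfaces.** $\operatorname{PL}_1(V)$ is the group generated by kites, subject to: 1. $(\mathbf w_1,\mathbf b_1)(\mathbf w_2,\mathbf b_2)\sim(\mathbf w_1,\mathbf b_1\mathbf u\mathbf b_2\mathbf u^{-1})$ with $\mathbf u=\mathbf w_1^{-1}\mathbf w_2$, whenever $\mathbf b_1\mathbf u\mathbf b_2\mathbf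 u^{-1}$ is a planar loop; 2. $(\mathbf w,\emptyset)\sim 1$; 3. $(\mathbf w,\mathbf x\mathbf b\mathbf x^{-1})\sim(\mathbf w\mathbf x,\mathbf b)$ whenever $\mathbf x\mathbf b\mathbf x^{-1}$ is a planar loop; 4. (Peiffer) $(\mathbf w_1\mathbf b_1\mathbf w_1^{-1}\mathbf w_2,\mathbf b_2)\sim(\mathbf w_1,\mathbf b_1)(\mathbf w_2,\mathbf b_2)(\mathbf w_1,\mathbf b_1)^{-1}$. **Representatives.** A marked kite is a pair $(w,\mathbf b)$ of a word $w\in\mathsf{FMon}(V)$ and a planar loop $\mathbf b$; it is triangular if $\mathbf b=(b_1,b_2,b_3)_{\min}$. A marked representative of $\mathbf X\in\operatorname{PL}_1(V)$ is a finite word $(X_1,\dots,X_k)$ of marked kites whose product in $\operatorname{PL}_1(V)$ is $\mathbf X$; it is triangulated if every $X_j$ is triangular. **Associated complex.** A piecewise linear simplicial complex in $V$ is a finite simplicial complex whose vertices lie in $V$ and are totally ordered. For a simplex $\sigma$, let $|\sigma|\subset V$ be the convex hull of its vertices. For a triangular marked kite $X=((w_1,\dots,w_m),(b_1,b_2,b_3)_{\min})$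 put $\hat w_k=w_1+\dots+w_k$ for $0\le k\le m$, $\hat b_1=\hat w_m+b_1$ and $\hat b_2=\hat b_1+b_2$. Then $\Delta(X)$ is the complex with vertices $\hat w_0,\dots,\hat w_m,\hat b_1,\hat b_2$, with edges $[\hat w_i,\hat w_{i+1}]$ $(0\le i<m)$, $[\hat w_m,\hat b_1]$, $[\hat b_1,\hat b_2]$, $[\hat b_2,\hat w_m]$, and with the $2$-simplex $[\hat w_m,\hat b_1,\hat b_2]$, where simplices are regarded as vertex sets and repetitions are removed. For a triangulated representative $r=(X_1,\dots,X_k)$ put $\Delta(r)=\bigcup_j\Delta(X_j)$. **Theorem.** Every $\mathbf X\in\operatorname{PL}_1(V)$ has a triangulated marked representative $r$ whose complex $\Delta(r)$ is compatible: for any two simplices $\sigma,\sigma'$ of $\Delta(r)$, either $|\sigma|\cap|\sigma'|=|\tau|$ for some common face $\tau$ of $\sigma$ and $\sigma'$, or $|\sigma|\cap|\sigma'|=\emptyset$. Moreover, the realization map from the geometric realization of the abstract simplicial complex $\Delta(r)$ to $V$, affine on each simplex and the identity on vertices, is a topological embedding. -/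

import Mathlib

namespace PLSurface

variable {V : Type*} [AddCommGroup V] [Module ℝ V]

/-! ### The group of piecewise linear paths -/

/-- Two vectors are linearly dependent. -/
def Dep (v w : V) : Prop := ¬ LinearIndependent ℝ ![v, w]

variable (V) in
/-- The defining relations of the group of piecewise linear paths. -/
inductive PL0Rel : FreeMonoid V → FreeMonoid V → Prop
  | add (v w : V) (h : Dep v w) :
      PL0Rel (FreeMonoid.of v * FreeMonoid.of w) (FreeMonoid.of (v + w))
  | zero : PL0Rel (FreeMonoid.of 0) 1

variable (V) in
/-- The group of piecewise linear paths: the free monoid on the set `V` modulo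
`(v, w) ∼ (v + w)` for linearly dependent `v, w`, and `(0) ∼ ∅`. -/
def PL0 : Type _ := PresentedMonoid (PL0Rel V)

noncomputable instance PL0.instMonoid : Monoid (PL0 V) :=
  inferInstanceAs (Monoid (PresentedMonoid (PL0Rel V)))

variable (V) in
/-- The quotient map from words to piecewise linear paths. -/
def PL0.mk : FreeMonoid V →* PL0 V := PresentedMonoid.mk (PL0Rel V)

theorem dep_iff {v w : V} : Dep v w ↔ v = 0 ∨ ∃ c : ℝ, w = c • v := by
  unfold Dep
  by_cases hv : v = 0
  · simp only [hv, true_or, iff_true]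
    intro h
    exact h.ne_zero 0 rfl
  · rw [LinearIndependent.pair_iff' hv]
    simp [hv, eq_comm]

theorem dep_smul_smul (a b : ℝ) (u : V) : Dep (a • u) (b • u) := by
  rw [dep_iff]
  by_cases ha : a = 0
  · left; simp [ha]
  · right
    exact ⟨b / a, by rw [smul_smul, div_mul_cancel₀ _ ha]⟩

theorem exists_smul_of_dep {v u : V} (hu : u ≠ 0) (h : Dep v u) : ∃ c : ℝ, v = c • u := by
  rcases dep_iff.1 h with h | ⟨c, hc⟩
  · exact ⟨0, by simp [h]⟩
  · have hc0 : c ≠ 0 := by rintro rfl; simp at hc; exact hu hc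
    exact ⟨c⁻¹, by rw [hc, smul_smul, inv_mul_cancel₀ hc0, one_smul]⟩

theorem PL0.mk_add {v w : V} (h : Dep v w) :
    PL0.mk V (FreeMonoid.of v) * PL0.mk V (FreeMonoid.of w) =
      PL0.mk V (FreeMonoid.of (v + w)) := by
  rw [← map_mul]
  exact PresentedMonoid.mk_eq_mk_of_rel (PL0Rel.add v w h)

theorem PL0.mk_zero : PL0.mk V (FreeMonoid.of 0) = 1 :=
  PresentedMonoid.mk_eq_mk_of_rel PL0Rel.zero

theorem PL0.mk_mul_mk_neg (v : V) :
    PL0.mk V (FreeMonoid.of v) * PL0.mk V (FreeMonoid.of (-v)) = 1 := by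
  have h : Dep v (-v) := by simpa using dep_smul_smul 1 (-1) v
  rw [PL0.mk_add h, add_neg_cancel, PL0.mk_zero]

theorem PL0.isUnit (x : PL0 V) : IsUnit x := by
  obtain ⟨a, rfl⟩ : ∃ a, PL0.mk V a = x := PresentedMonoid.surjective_mk x
  induction a with
  | one => exact isUnit_one
  | of v =>
    have h := PL0.mk_mul_mk_neg (-v)
    rw [neg_neg] at h
    exact ⟨⟨_, _, PL0.mk_mul_mk_neg v, h⟩, rfl⟩
  | mul a b ha hb => rw [map_mul]; exact ha.mul hb

/-- The inverse is the unique one; that of `(v₁, …, vₖ)` is `(-vₖ, …, -v₁)`. -/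
noncomputable instance PL0.instGroup : Group (PL0 V) where
  inv x := ↑(PL0.isUnit x).unit⁻¹
  inv_mul_cancel x := (PL0.isUnit x).val_inv_mul

/-- The endpoint homomorphism `(v₁, …, vₖ) ↦ ∑ vᵢ`. -/
def PL0.endpoint : PL0 V →* Multiplicative V :=
  PresentedMonoid.lift (rels := PL0Rel V) Multiplicative.ofAdd (by
    intro a b h
    cases h with
    | add v w h => simp
    | zero => simp)

/-! ### Minimal representatives -/

/-- A word is minimal if its letters are nonzero and consecutive letters are linearly
independent. -/
def IsMinimalWord (l : List V) : Prop :=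
  (∀ v ∈ l, v ≠ 0) ∧ l.IsChain (fun v w => LinearIndependent ℝ ![v, w])

theorem isMinimalWord_cons_cons {v u : V} {t : List V} :
    IsMinimalWord (v :: u :: t) ↔ ¬ Dep v u ∧ IsMinimalWord (u :: t) := by
  simp only [IsMinimalWord, List.isChain_cons_cons, Dep, not_not, List.forall_mem_cons]
  constructor
  · rintro ⟨⟨_, h2⟩, h3, h4⟩; exact ⟨h3, h2, h4⟩
  · rintro ⟨h3, h2, h4⟩; exact ⟨⟨h3.ne_zero 0, h2⟩, h3, h4⟩

theorem isMinimalWord_singleton {v : V} : IsMinimalWord [v] ↔ v ≠ 0 := by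
  simp [IsMinimalWord]

theorem isMinimalWord_nil : IsMinimalWord ([] : List V) := by
  simp [IsMinimalWord]

theorem IsMinimalWord.tail {v : V} {t : List V} (h : IsMinimalWord (v :: t)) :
    IsMinimalWord t := by
  cases t with
  | nil => exact isMinimalWord_nil
  | cons u t => exact (isMinimalWord_cons_cons.1 h).2

theorem IsMinimalWord.head_ne {v : V} {t : List V} (h : IsMinimalWord (v :: t)) : v ≠ 0 :=
  h.1 v (by simp)

theorem IsMinimalWord.smul_head {u : V} {t : List V} (h : IsMinimalWord (u :: t))
    {c : ℝ} (hc : c • u ≠ 0) : IsMinimalWord (c • u :: t) := by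
  cases t with
  | nil => exact isMinimalWord_singleton.2 hc
  | cons x t =>
    rw [isMinimalWord_cons_cons] at h ⊢
    refine ⟨fun hd => h.1 ?_, h.2⟩
    obtain ⟨d, hd⟩ := exists_smul_of_dep h.2.head_ne hd
    have hc0 : c ≠ 0 := by rintro rfl; simp at hc
    have : u = (c⁻¹ * d) • x := by
      rw [mul_smul, ← hd, smul_smul, inv_mul_cancel₀ hc0, one_smul]
    rw [this]
    simpa using dep_smul_smul (c⁻¹ * d) 1 x

open Classical in
/-- Concatenate a letter with a minimal word and reduce. -/
noncomputable def push (v : V) (l : List V) : List V :=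
  if v = 0 then l else
    match l with
    | [] => [v]
    | u :: t => if Dep v u then (if v + u = 0 then t else (v + u) :: t) else v :: u :: t

theorem push_zero (l : List V) : push 0 l = l := by simp [push]

theorem push_of_minimal {v : V} {l : List V} (h : IsMinimalWord (v :: l)) :
    push v l = v :: l := by
  cases l with
  | nil => simp [push, h.head_ne]
  | cons u t => simp [push, h.head_ne, (isMinimalWord_cons_cons.1 h).1]

open Classical in
theorem push_cons_of_dep {v u : V} {t : List V} (hu : u ≠ 0) (h : Dep v u) :
    push v (u :: t) = if v + u = 0 then t else (v + u) :: t := by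
  by_cases hv : v = 0
  · simp [push, hv, hu]
  · simp [push, hv, h]

theorem push_minimal (v : V) {l : List V} (h : IsMinimalWord l) : IsMinimalWord (push v l) := by
  by_cases hv : v = 0
  · rw [hv, push_zero]; exact h
  cases l with
  | nil => simpa [push, hv] using isMinimalWord_singleton.2 hv
  | cons u t =>
    by_cases hd : Dep v u
    · rw [push_cons_of_dep h.head_ne hd]
      split_ifs with h0
      · exact h.tail
      · obtain ⟨c, rfl⟩ := exists_smul_of_dep h.head_ne hd
        have e : c • u + u = (c + 1) • u := by rw [add_smul, one_smul]
        rw [e] at h0 ⊢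
        exact h.smul_head h0
    · have hm := isMinimalWord_cons_cons.2 ⟨hd, h⟩
      rwa [push_of_minimal hm]

theorem push_push_smul {u : V} (a b : ℝ) {t : List V} (h : IsMinimalWord (u :: t)) :
    push (a • u) (push (b • u) t) = push (a • u + b • u) t := by
  have hp : ∀ c : ℝ, c • u ≠ 0 → push (c • u) t = c • u :: t := fun c hc =>
    push_of_minimal (h.smul_head hc)
  by_cases hb : b • u = 0
  · rw [hb, push_zero, add_zero]
  · rw [hp b hb, push_cons_of_dep hb (dep_smul_smul a b u)]
    split_ifs with h0
    · rw [h0, push_zero]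
    · rw [← add_smul] at h0 ⊢
      rw [hp _ h0]

theorem push_push {v w : V} (hd : Dep v w) {l : List V} (h : IsMinimalWord l) :
    push v (push w l) = push (v + w) l := by
  by_cases hw : w = 0
  · rw [hw, push_zero, add_zero]
  obtain ⟨a, rfl⟩ := exists_smul_of_dep hw hd
  by_cases hm : IsMinimalWord (w :: l)
  · simpa using push_push_smul a 1 hm
  · cases l with
    | nil => exact absurd (isMinimalWord_singleton.2 hw) hm
    | cons u t =>
      have hwu : Dep w u := by
        by_contra hn
        exact hm (isMinimalWord_cons_cons.2 ⟨hn, h⟩)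
      obtain ⟨c, rfl⟩ := exists_smul_of_dep h.head_ne hwu
      have hu : u :: t = push ((1 : ℝ) • u) t := by rw [one_smul, push_of_minimal h]
      have e : a • c • u + c • u = (a * c + c) • u := by rw [add_smul, mul_smul]
      rw [hu, push_push_smul _ _ h, e, push_push_smul _ _ h,
        ← add_smul, smul_smul, push_push_smul _ _ h, ← add_smul, ← add_smul]
      congr 2
      ring

/-- The action of paths on minimal words by concatenation followed by reduction. -/
noncomputable def PL0.act : PL0 V →* Function.End {l : List V // IsMinimalWord l} :=
  PresentedMonoid.lift (rels := PL0Rel V) (fun v l => ⟨push v l.1, push_minimal v l.2⟩) (by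
    intro a b h
    cases h with
    | add v w h =>
      funext l
      exact Subtype.ext (push_push h l.2)
    | zero =>
      funext l
      exact Subtype.ext (push_zero l.1))

theorem PL0.act_of (v : V) (l : {l : List V // IsMinimalWord l}) :
    (PL0.act (PL0.mk V (FreeMonoid.of v)) l).1 = push v l.1 := rfl

theorem PL0.act_one (l : {l : List V // IsMinimalWord l}) : PL0.act 1 l = l := by
  rw [map_one]; rfl

theorem PL0.act_mul (x y : PL0 V) (l : {l : List V // IsMinimalWord l}) :
    PL0.act (x * y) l = PL0.act x (PL0.act y l) := by
  rw [map_mul]; rfl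

theorem PL0.mk_push (v : V) {l : List V} (h : IsMinimalWord l) :
    PL0.mk V (FreeMonoid.ofList (push v l)) =
      PL0.mk V (FreeMonoid.of v) * PL0.mk V (FreeMonoid.ofList l) := by
  by_cases hv : v = 0
  · rw [hv, push_zero, PL0.mk_zero, one_mul]
  cases l with
  | nil => simp [push, hv]
  | cons u t =>
    by_cases hd : Dep v u
    · rw [push_cons_of_dep h.head_ne hd, FreeMonoid.ofList_cons u t, map_mul, ← mul_assoc,
        PL0.mk_add hd]
      split_ifs with h0
      · rw [h0, PL0.mk_zero, one_mul]
      · rw [FreeMonoid.ofList_cons, map_mul]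
    · rw [push_of_minimal (isMinimalWord_cons_cons.2 ⟨hd, h⟩), FreeMonoid.ofList_cons, map_mul]

theorem PL0.mk_act (x : PL0 V) (l : {l : List V // IsMinimalWord l}) :
    PL0.mk V (FreeMonoid.ofList (PL0.act x l).1) = x * PL0.mk V (FreeMonoid.ofList l.1) := by
  obtain ⟨a, rfl⟩ : ∃ a, PL0.mk V a = x := PresentedMonoid.surjective_mk x
  induction a generalizing l with
  | one => rw [map_one, PL0.act_one, one_mul]
  | of v => rw [PL0.act_of, PL0.mk_push v l.2]
  | mul a b ha hb =>
    rw [map_mul, PL0.act_mul, ha, hb, mul_assoc]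

theorem PL0.act_of_minimal {l : List V} (h : IsMinimalWord l) :
    (PL0.act (PL0.mk V (FreeMonoid.ofList l)) ⟨[], isMinimalWord_nil⟩).1 = l := by
  induction l with
  | nil => rw [FreeMonoid.ofList_nil, map_one, PL0.act_one]
  | cons v t ih =>
    rw [FreeMonoid.ofList_cons, map_mul, PL0.act_mul, PL0.act_of, ih h.tail, push_of_minimal h]

/-- Every path has a unique minimal representative. -/
theorem PL0.existsUnique_minimal (x : PL0 V) :
    ∃! l : List V, IsMinimalWord l ∧ PL0.mk V (FreeMonoid.ofList l) = x := by
  refine ⟨(PL0.act x ⟨[], isMinimalWord_nil⟩).1, ⟨(PL0.act x _).2, ?_⟩, ?_⟩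
  · rw [PL0.mk_act]; simp
  · rintro l ⟨hl, rfl⟩
    exact (PL0.act_of_minimal hl).symm

/-- The minimal representative `(v₁, …, vₙ)_min` of a path. -/
noncomputable def PL0.minimalWord (x : PL0 V) : List V := (PL0.existsUnique_minimal x).choose

theorem PL0.minimalWord_spec (x : PL0 V) :
    IsMinimalWord x.minimalWord ∧ PL0.mk V (FreeMonoid.ofList x.minimalWord) = x :=
  (PL0.existsUnique_minimal x).choose_spec.1

/-- The span of a path: the linear span of the letters of its minimal representative. -/
noncomputable def PL0.span (x : PL0 V) : Submodule ℝ V :=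
  Submodule.span ℝ {v | v ∈ x.minimalWord}

/-! ### The group of piecewise linear surfaces -/

variable (V) in
/-- Planar loops: closed paths whose span has dimension at most two. -/
def PlanarLoop : Type _ :=
  {x : PL0 V // PL0.endpoint x = 1 ∧ Module.finrank ℝ x.span ≤ 2}

variable (V) in
/-- Kites: pairs of a tail path and a planar loop. -/
def Kite : Type _ := PL0 V × PlanarLoop V

variable (V) in
/-- The defining relations of the pre-crossed module of piecewise linear surfaces. -/
inductive PL1PreRel : FreeGroup (Kite V) → FreeGroup (Kite V) → Prop
  | concat (w₁ w₂ : PL0 V) (b₁ b₂ b : PlanarLoop V)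
      (h : b.1 = b₁.1 * (w₁⁻¹ * w₂) * b₂.1 * (w₁⁻¹ * w₂)⁻¹) :
      PL1PreRel (FreeGroup.of (w₁, b₁) * FreeGroup.of (w₂, b₂)) (FreeGroup.of (w₁, b))
  | trivial (w : PL0 V) (b : PlanarLoop V) (h : b.1 = 1) :
      PL1PreRel (FreeGroup.of (w, b)) 1
  | conj (w x : PL0 V) (b b' : PlanarLoop V) (h : b'.1 = x * b.1 * x⁻¹) :
      PL1PreRel (FreeGroup.of (w, b')) (FreeGroup.of (w * x, b))

variable (V) in
/-- The top group of the pre-crossed module of piecewise linear surfaces. -/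
def PL1Pre : Type _ := (conGen (PL1PreRel V)).Quotient

noncomputable instance PL1Pre.instGroup : Group (PL1Pre V) :=
  inferInstanceAs (Group (conGen (PL1PreRel V)).Quotient)

/-- The class of a kite in the pre-crossed module. -/
noncomputable def PL1Pre.ofKite (X : Kite V) : PL1Pre V := (conGen (PL1PreRel V)).mk' (FreeGroup.of X)

/-- The boundary of a kite. -/
noncomputable def Kite.boundary (X : Kite V) : PL0 V := X.1 * X.2.1 * X.1⁻¹

/-- The action of paths on kites. -/
noncomputable def Kite.act (x : PL0 V) (X : Kite V) : Kite V := (x * X.1, X.2)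

variable (V) in
/-- The Peiffer relations `δ(X) ▷ Y ∼ X Y X⁻¹` on kites; the inverse of `(w, b)` is
`(w, b⁻¹)`. -/
inductive PeifferRel : PL1Pre V → PL1Pre V → Prop
  | peiffer (X Y : Kite V) :
      PeifferRel (PL1Pre.ofKite (Kite.act X.boundary Y))
        (PL1Pre.ofKite X * PL1Pre.ofKite Y * (PL1Pre.ofKite X)⁻¹)

variable (V) in
/-- The group of piecewise linear surfaces. -/
def PL1 : Type _ := (conGen (PeifferRel V)).Quotient

noncomputable instance PL1.instGroup : Group (PL1 V) :=
  inferInstanceAs (Group (conGen (PeifferRel V)).Quotient)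

/-- The class of a kite in the group of piecewise linear surfaces. -/
noncomputable def PL1.ofKite (X : Kite V) : PL1 V := (conGen (PeifferRel V)).mk' (PL1Pre.ofKite X)

/-! ### Marked representatives -/

variable (V) in
/-- Marked kites: a word representing the tail path, and a planar loop. -/
def MarkedKite : Type _ := FreeMonoid V × PlanarLoop V

/-- The kite underlying a marked kite. -/
noncomputable def MarkedKite.toKite (X : MarkedKite V) : Kite V := (PL0.mk V X.1, X.2)

/-- The homomorphism from words in marked kites to the group of piecewise linear surfaces. -/
noncomputable def realize : FreeMonoid (MarkedKite V) →* PL1 V :=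
  FreeMonoid.lift (fun X => PL1.ofKite X.toKite)

/-- The word `r` in marked kites is a marked representative of `X`. -/
def IsRepresentative (r : FreeMonoid (MarkedKite V)) (X : PL1 V) : Prop := realize r = X

/-- A marked kite is triangular if the minimal representative of its loop has three letters. -/
def MarkedKite.IsTriangular (X : MarkedKite V) : Prop :=
  ∃ b₁ b₂ b₃ : V, X.2.1.minimalWord = [b₁, b₂, b₃]

/-- A marked representative is triangulated if each of its marked kites is triangular. -/
def IsTriangulated (r : FreeMonoid (MarkedKite V)) : Prop :=
  ∀ X ∈ FreeMonoid.toList r, X.IsTriangular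

/-! ### Piecewise linear simplicial complexes -/

/-- A piecewise linear simplicial complex in `E`: a finite simplicial complex whose vertices
are points of `E` and are totally ordered, by their position in the list `vertices`. A simplex
is given by its nonempty set of vertices. -/
structure PLSC (E : Type*) extends PreAbstractSimplicialComplex E where
  /-- The ordered list of vertices. -/
  vertices : List E
  nodup_vertices : vertices.Nodup
  mem_vertices_iff : ∀ p, p ∈ vertices ↔ {p} ∈ faces

/-- The set `|σ|`: the convex hull of the vertices of a simplex. -/
def realizedSimplex (σ : Finset V) : Set V := convexHull ℝ (σ : Set V)

/-- Any two simplices meet, after realization, in a common face or not at all. -/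
def PLSC.IsCompatible (C : PLSC V) : Prop :=
  ∀ σ ∈ C.faces, ∀ σ' ∈ C.faces,
    (∃ τ ∈ C.faces, τ ⊆ σ ∧ τ ⊆ σ' ∧
      realizedSimplex σ ∩ realizedSimplex σ' = realizedSimplex τ) ∨
    realizedSimplex σ ∩ realizedSimplex σ' = ∅

/-- The geometric realization of the underlying abstract simplicial complex, in barycentric
coordinates, as a subspace of a finite-dimensional real coordinate space. -/
def PLSC.Geom (C : PLSC V) : Type _ :=
  {t : {p // p ∈ C.vertices} → ℝ //
    (∀ p, 0 ≤ t p) ∧ ∑ᶠ p, t p = 1 ∧ ∃ σ ∈ C.faces, ∀ p, t p ≠ 0 → p.1 ∈ σ}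

instance PLSC.Geom.instTopologicalSpace (C : PLSC V) : TopologicalSpace C.Geom :=
  inferInstanceAs (TopologicalSpace {t : {p // p ∈ C.vertices} → ℝ //
    (∀ p, 0 ≤ t p) ∧ ∑ᶠ p, t p = 1 ∧ ∃ σ ∈ C.faces, ∀ p, t p ≠ 0 → p.1 ∈ σ})

/-- The realization map, which sends a point of the geometric realization to the point of `V`
with the same barycentric coordinates. -/
noncomputable def PLSC.realization (C : PLSC V) (t : C.Geom) : V := ∑ᶠ p, t.1 p • p.1

open Classical in
/-- Delete repetitions from a list, keeping first occurrences. -/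
noncomputable def dedupFirst {E : Type*} (l : List E) : List E := l.reverse.dedup.reverse

theorem mem_dedupFirst {E : Type*} {l : List E} {p : E} : p ∈ dedupFirst l ↔ p ∈ l := by
  simp [dedupFirst]

theorem nodup_dedupFirst {E : Type*} (l : List E) : (dedupFirst l).Nodup := by
  classical
  simp [dedupFirst, List.nodup_reverse, List.nodup_dedup]

/-- The complex with no simplices. -/
def PLSC.empty (E : Type*) : PLSC E where
  faces := ∅
  isRelLowerSet_faces := by simp [IsRelLowerSet]
  vertices := []
  nodup_vertices := by simp
  mem_vertices_iff := by simp

/-- The union of two complexes; the new vertices of the second come after those of the first. -/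
noncomputable def PLSC.union {E : Type*} (C D : PLSC E) : PLSC E where
  faces := C.faces ∪ D.faces
  isRelLowerSet_faces := C.isRelLowerSet_faces.union D.isRelLowerSet_faces
  vertices := dedupFirst (C.vertices ++ D.vertices)
  nodup_vertices := nodup_dedupFirst _
  mem_vertices_iff := by
    intro p
    simp [mem_dedupFirst, C.mem_vertices_iff, D.mem_vertices_iff]

/-! ### The complex associated to a triangulated representative -/

/-- The points `ŵ₀ = 0, ŵ₁, …, ŵₘ` visited by the tail, with `ŵₖ = w₁ + ⋯ + wₖ`. -/
def tailPoints {E : Type*} [AddCommGroup E] (w : List E) : List E := w.scanl (· + ·) 0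

open Classical in
/-- The simplices `Δ₀ ∪ Δ₁ ∪ Δ₂` of a triangular kite whose tail visits the points `pts`,
ending at `q`, and whose triangle has vertices `q, r, s`. -/
def kiteFaces {E : Type*} (pts : List E) (q r s : E) : Set (Finset E) :=
  {σ | ∃ p ∈ pts ++ [r, s], σ = {p}} ∪
  ({σ | ∃ p p', [p, p'] <:+: pts ∧ σ = {p, p'}} ∪ {{q, r}, {r, s}, {s, q}}) ∪
  {{q, r, s}}

open Classical in
theorem pair_cases {E : Type*} {a b : E} {t : Finset E} (ht : t ⊆ {a, b}) (hne : t.Nonempty) :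
    t = {a} ∨ t = {b} ∨ t = {a, b} := by
  have hx : ∀ x ∈ t, x = a ∨ x = b := fun x hx => by simpa using ht hx
  by_cases ha : a ∈ t
  · by_cases hb : b ∈ t
    · right; right
      exact ht.antisymm (by simp [Finset.insert_subset_iff, ha, hb])
    · left
      refine Finset.eq_singleton_iff_unique_mem.2 ⟨ha, fun x hxt => ?_⟩
      rcases hx x hxt with rfl | rfl
      · rfl
      · exact absurd hxt hb
  · right; left
    obtain ⟨y, hy⟩ := hne
    have hnb : ∀ x ∈ t, x = b := fun x hxt =>
      (hx x hxt).resolve_left (by rintro rfl; exact ha hxt)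
    exact Finset.eq_singleton_iff_unique_mem.2 ⟨hnb y hy ▸ hy, hnb⟩

theorem kiteFaces_isRelLowerSet {E : Type*} (pts : List E) (q r s : E) (hq : q ∈ pts) :
    IsRelLowerSet (kiteFaces pts q r s) Finset.Nonempty := by
  classical
  intro σ hσ
  have hmem : ∀ p p', [p, p'] <:+: pts → p ∈ pts ∧ p' ∈ pts := fun p p' h =>
    ⟨h.subset (by simp), h.subset (by simp)⟩
  have hdown : ∀ a b : E, ({a} : Finset E) ∈ kiteFaces pts q r s →
      ({b} : Finset E) ∈ kiteFaces pts q r s → ({a, b} : Finset E) ∈ kiteFaces pts q r s →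
      ∀ t ⊆ ({a, b} : Finset E), t.Nonempty → t ∈ kiteFaces pts q r s := by
    intro a b ha hb hab t ht hne
    have h0 : t = {a} ∨ t = {b} ∨ t = {a, b} := pair_cases ht hne
    rcases h0 with rfl | rfl | rfl <;> assumption
  have hv : ∀ p, p ∈ pts ++ [r, s] → ({p} : Finset E) ∈ kiteFaces pts q r s :=
    fun p hp => Or.inl (Or.inl ⟨p, hp, rfl⟩)
  have hq' := hv q (by simp [hq])
  have hr' := hv r (by simp)
  have hs' := hv s (by simp)
  have hqr : ({q, r} : Finset E) ∈ kiteFaces pts q r s :=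
    Or.inl (Or.inr (Or.inr (Or.inl rfl)))
  have hrs : ({r, s} : Finset E) ∈ kiteFaces pts q r s :=
    Or.inl (Or.inr (Or.inr (Or.inr (Or.inl rfl))))
  have hsq : ({s, q} : Finset E) ∈ kiteFaces pts q r s :=
    Or.inl (Or.inr (Or.inr (Or.inr (Or.inr rfl))))
  have hall : ({q, r, s} : Finset E) ∈ kiteFaces pts q r s := Or.inr rfl
  have key : ∀ t ⊆ σ, t.Nonempty → t ∈ kiteFaces pts q r s := by
    rcases hσ with (⟨p, hp, rfl⟩ | ⟨p, p', h, rfl⟩ | rfl | rfl | rfl) | rfl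
    · intro t ht hne
      rcases Finset.subset_singleton_iff.1 ht with rfl | rfl
      · exact absurd hne (by simp)
      · exact hv p hp
    · exact hdown p p' (hv p (by simp [(hmem p p' h).1])) (hv p' (by simp [(hmem p p' h).2]))
        (Or.inl (Or.inr (Or.inl ⟨p, p', h, rfl⟩)))
    · exact hdown q r hq' hr' hqr
    · exact hdown r s hr' hs' hrs
    · exact hdown s q hs' hq' hsq
    · intro t ht hne
      have hx : ∀ x ∈ t, x = q ∨ x = r ∨ x = s := fun x hx => by simpa using ht hx
      have tsub : ∀ a b : E, (∀ x ∈ t, x = a ∨ x = b) → t ⊆ {a, b} := fun a b h x hxt => by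
        simpa using h x hxt
      by_cases h1 : q ∈ t <;> by_cases h2 : r ∈ t <;> by_cases h3 : s ∈ t
      · have : t = {q, r, s} := by
          refine ht.antisymm ?_
          simp [Finset.insert_subset_iff, h1, h2, h3]
        rwa [this]
      · exact hdown q r hq' hr' hqr t (tsub _ _ (by intro x hxt; rcases hx x hxt with rfl | rfl | rfl <;> tauto)) hne
      · exact hdown s q hs' hq' hsq t (tsub _ _ (by intro x hxt; rcases hx x hxt with rfl | rfl | rfl <;> tauto)) hne
      · exact hdown s q hs' hq' hsq t (tsub _ _ (by intro x hxt; rcases hx x hxt with rfl | rfl | rfl <;> tauto)) hne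
      all_goals exact hdown r s hr' hs' hrs t (tsub _ _ (by intro x hxt; rcases hx x hxt with rfl | rfl | rfl <;> tauto)) hne
  have hne : σ.Nonempty := by
    rcases hσ with (⟨p, hp, rfl⟩ | ⟨p, p', h, rfl⟩ | rfl | rfl | rfl) | rfl <;> simp
  exact ⟨hne, fun t ht hn => key t ht hn⟩

theorem singleton_mem_kiteFaces {E : Type*} (pts : List E) (q r s : E) (hq : q ∈ pts) (p : E) :
    p ∈ pts ++ [r, s] ↔ {p} ∈ kiteFaces pts q r s := by
  classical
  constructor
  · intro hp
    exact Or.inl (Or.inl ⟨p, hp, rfl⟩)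
  · have hmem : ∀ σ ∈ kiteFaces pts q r s, ∀ x ∈ σ, x ∈ pts ++ [r, s] := by
      rintro σ ((⟨p, hp, rfl⟩ | ⟨p, p', h, rfl⟩ | rfl | rfl | rfl) | rfl) x hx
      · rw [Finset.mem_singleton.1 hx]; exact hp
      · have h1 : p ∈ pts := h.subset (by simp)
        have h2 : p' ∈ pts := h.subset (by simp)
        grind
      all_goals grind
    intro h
    exact hmem _ h p (by simp)

theorem add_sum_mem_scanl {E : Type*} [AddCommGroup E] (x : E) (w : List E) : x + w.sum ∈ w.scanl (· + ·) x := by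
  induction w generalizing x with
  | nil => simp
  | cons v w ih =>
    rw [List.scanl_cons, List.sum_cons, ← add_assoc]
    exact List.mem_cons_of_mem _ (ih _)

theorem sum_mem_tailPoints {E : Type*} [AddCommGroup E] (w : List E) : w.sum ∈ tailPoints w := by
  simpa [tailPoints] using add_sum_mem_scanl 0 w

/-- The complex of a triangular kite with tail word `w` and loop `(b₁, b₂, -b₁ - b₂)`, where
`b̂₁ = ŵₘ + b₁` and `b̂₂ = b̂₁ + b₂`. -/
noncomputable def triangularKiteComplex (w : List V) (b₁ b₂ : V) : PLSC V where
  faces := kiteFaces (tailPoints w) w.sum (w.sum + b₁) (w.sum + b₁ + b₂)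
  isRelLowerSet_faces := kiteFaces_isRelLowerSet _ _ _ _ (sum_mem_tailPoints w)
  vertices := dedupFirst (tailPoints w ++ [w.sum + b₁, w.sum + b₁ + b₂])
  nodup_vertices := nodup_dedupFirst _
  mem_vertices_iff p := by
    rw [mem_dedupFirst]
    exact singleton_mem_kiteFaces _ _ _ _ (sum_mem_tailPoints w) p

/-- The complex `Δ(X)` associated to a marked triangular kite (and, by convention, the complex
with no simplices if the marked kite is not triangular). -/
noncomputable def MarkedKite.complex (X : MarkedKite V) : PLSC V :=
  match X.2.1.minimalWord with
  | [b₁, b₂, _] => triangularKiteComplex (FreeMonoid.toList X.1) b₁ b₂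
  | _ => PLSC.empty V

/-- The complex associated to a triangulated representative: the union of those of its
marked kites. -/
noncomputable def associatedComplex (r : FreeMonoid (MarkedKite V)) : PLSC V :=
  ((FreeMonoid.toList r).map MarkedKite.complex).foldr PLSC.union (PLSC.empty V)

end PLSurface

/-! The complex is found inside the order complex of a hyperplane arrangement. A finite list `A` of
affine functionals divides `V` into cells, one for each sign vector that occurs, ordered by the face
relation `Below`. One point, the center, is chosen in each cell. A convex combination with positive
weights of the centers of a chain of cells lies in the largest cell of the chain. A point therefore
determines the top of its chain, then the weight of the top, and inductively the chain and all
weights (`flag_combination_unique`). Hence every finite complex made of flags is compatible and has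
an injective realization, which is an embedding by compactness. It remains to find a triangulated
representative made of flags.

This is done by simplicial approximation: each point moves to the center of its cell. A segment
between comparable cells lies in the larger one except perhaps for an endpoint, so the image of a
segment is well defined in `PL0` (`IsImage.unique`), and it is an edge path in the complex of flags.
Every triangle can be cut into triangles with pairwise comparable vertices (`triangle_induction`),
whose images are flags. Rotating and gluing triangles correspond to the conjugation and
concatenation relations on kites.

The approximation does not change the given surface if `A` contains functionals that cut out the
relevant vertices, edge lines and loop planes (`forFine_resolves`). Vertices are then fixed, the
image of an edge runs along its own line and reduces to the edge (`image_add`), and images of planar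
loops stay planar. Thus each tail is the class of an edge path, and each planar loop is the product
of the images of the triangles of a fan. These conditions persist when functionals are added
(`ForFine`), so one arrangement serves all the kites of a surface. -/

namespace PLSurface

variable {V : Type*} [AddCommGroup V] [Module ℝ V]

/-! ### Cells of an arrangement of affine functionals -/

/-- The face order on the cells of an arrangement, as a preorder on points: every functional
that does not vanish at `x` has the same sign at `x` and at `y`. -/
def Below (A : List (V →ᵃ[ℝ] ℝ)) (x y : V) : Prop := ∀ f ∈ A, f x = 0 ∨ 0 < f x * f y

/-- Two points are comparable if one of their cells is a face of the other. -/
def Comparable (A : List (V →ᵃ[ℝ] ℝ)) (x y : V) : Prop := Below A x y ∨ Below A y x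

theorem Below.refl (A : List (V →ᵃ[ℝ] ℝ)) (x : V) : Below A x x := fun f _ => by
  rcases eq_or_ne (f x) 0 with h | h
  · exact Or.inl h
  · exact Or.inr (mul_self_pos.2 h)

theorem Below.trans {A : List (V →ᵃ[ℝ] ℝ)} {x y z : V} (h : Below A x y) (h' : Below A y z) :
    Below A x z := fun f hf => by
  rcases h f hf with h1 | h1
  · exact Or.inl h1
  rcases h' f hf with h2 | h2
  · simp [h2] at h1
  · right
    -- The product of the two hypotheses is `f x * f z` times a square.
    have h3 : 0 < (f x * f z) * (f y * f y) := by nlinarith [mul_pos h1 h2]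
    exact pos_of_mul_pos_left h3 (mul_self_nonneg _)

theorem Comparable.symm {A : List (V →ᵃ[ℝ] ℝ)} {x y : V} (h : Comparable A x y) :
    Comparable A y x := Or.symm h

theorem Comparable.refl (A : List (V →ᵃ[ℝ] ℝ)) (x : V) : Comparable A x x :=
  Or.inl (Below.refl A x)

/-- The equivalence relation whose classes are the cells of an arrangement. -/
def cellSetoid (A : List (V →ᵃ[ℝ] ℝ)) : Setoid V where
  r x y := Below A x y ∧ Below A y x
  iseqv := ⟨fun x => ⟨Below.refl A x, Below.refl A x⟩, fun h => ⟨h.2, h.1⟩,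
    fun h h' => ⟨h.1.trans h'.1, h'.2.trans h.2⟩⟩

/-- A chosen point of the cell of `x`. -/
noncomputable def center (A : List (V →ᵃ[ℝ] ℝ)) (x : V) : V := (Quotient.mk (cellSetoid A) x).out

theorem center_below (A : List (V →ᵃ[ℝ] ℝ)) (x : V) : Below A (center A x) x :=
  (Quotient.mk_out (s := cellSetoid A) x).1

theorem below_center (A : List (V →ᵃ[ℝ] ℝ)) (x : V) : Below A x (center A x) :=
  (Quotient.mk_out (s := cellSetoid A) x).2

theorem center_eq_center {A : List (V →ᵃ[ℝ] ℝ)} {x y : V} (h : Below A x y) (h' : Below A y x) :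
    center A x = center A y := by
  unfold center
  rw [Quotient.sound (s := cellSetoid A) (show Below A x y ∧ Below A y x from ⟨h, h'⟩)]

theorem center_center (A : List (V →ᵃ[ℝ] ℝ)) (x : V) : center A (center A x) = center A x :=
  center_eq_center (center_below A x) (below_center A x)

theorem Comparable.center {A : List (V →ᵃ[ℝ] ℝ)} {x y : V} (h : Comparable A x y) :
    Comparable A (center A x) (center A y) :=
  h.imp (fun h => ((center_below A x).trans h).trans (below_center A y))
    (fun h => ((center_below A y).trans h).trans (below_center A x))

/-- A flag: a nonempty finite set of centers of cells that are pairwise comparable. -/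
def IsFlag (A : List (V →ᵃ[ℝ] ℝ)) (σ : Finset V) : Prop :=
  σ.Nonempty ∧ (∀ p ∈ σ, center A p = p) ∧ ∀ p ∈ σ, ∀ q ∈ σ, Comparable A p q

theorem IsFlag.subset {A : List (V →ᵃ[ℝ] ℝ)} {σ τ : Finset V} (h : IsFlag A σ) (hτ : τ ⊆ σ)
    (hne : τ.Nonempty) : IsFlag A τ :=
  ⟨hne, fun p hp => h.2.1 p (hτ hp), fun p hp q hq => h.2.2 p (hτ hp) q (hτ hq)⟩

/-- Pairwise comparability in a preorder makes a finite set a chain, so it has a largest element. -/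
theorem IsFlag.exists_top {A : List (V →ᵃ[ℝ] ℝ)} {σ : Finset V} (h : IsFlag A σ) :
    ∃ a ∈ σ, ∀ p ∈ σ, Below A p a := by
  classical
  obtain ⟨hne, -, hc⟩ := h
  induction hne using Finset.Nonempty.cons_induction with
  | singleton a => exact ⟨a, by simp, by simpa using Below.refl A a⟩
  | cons a s ha hs ih =>
    obtain ⟨b, hb, hb'⟩ := ih fun p hp q hq =>
      hc p (Finset.mem_cons_of_mem hp) q (Finset.mem_cons_of_mem hq)
    rcases hc a (Finset.mem_cons_self a s) b (Finset.mem_cons_of_mem hb) with h | h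
    · refine ⟨b, Finset.mem_cons_of_mem hb, fun p hp => ?_⟩
      rcases Finset.mem_cons.1 hp with rfl | hp
      exacts [h, hb' p hp]
    · refine ⟨a, Finset.mem_cons_self a s, fun p hp => ?_⟩
      rcases Finset.mem_cons.1 hp with rfl | hp
      exacts [Below.refl A _, (hb' p hp).trans h]

/-- The left side depends only on the vector sum and the total mass. The mass is kept general
because the uniqueness induction removes weight and leaves mass different from 1. -/
theorem sum_mul_apply (f : V →ᵃ[ℝ] ℝ) (σ : Finset V) (t : V → ℝ) :
    ∑ p ∈ σ, t p * f p = f.linear (∑ p ∈ σ, t p • p) + (∑ p ∈ σ, t p) * f 0 := by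
  rw [map_sum, Finset.sum_mul, ← Finset.sum_add_distrib]
  refine Finset.sum_congr rfl fun p _ => ?_
  have h : f p = f.linear p + f 0 := congrFun f.decomp p
  rw [h, map_smul, smul_eq_mul]
  ring

/-- The sign of a functional at a positive combination of a flag is that at the top. -/
theorem sum_mul_apply_top {A : List (V →ᵃ[ℝ] ℝ)} {σ : Finset V} {t : V → ℝ}
    (ht : ∀ p ∈ σ, 0 < t p) {a : V} (ha : a ∈ σ) (htop : ∀ p ∈ σ, Below A p a)
    {f : V →ᵃ[ℝ] ℝ} (hf : f ∈ A) :
    (f a = 0 ∧ ∑ p ∈ σ, t p * f p = 0) ∨ 0 < (∑ p ∈ σ, t p * f p) * f a := by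
  by_cases h0 : f a = 0
  · refine Or.inl ⟨h0, Finset.sum_eq_zero fun p hp => ?_⟩
    rcases htop p hp f hf with h | h
    · simp [h]
    · simp [h0] at h
  · right
    -- After multiplication by `f a` no term is negative, since no point below `a` has the opposite
    -- sign, and the term of `a` itself is positive.
    rw [Finset.sum_mul]
    refine Finset.sum_pos' (fun p hp => ?_) ⟨a, ha, ?_⟩
    · rw [mul_assoc]
      refine mul_nonneg (ht p hp).le ?_
      rcases htop p hp f hf with h | h
      · simp [h]
      · exact h.le
    · rw [mul_assoc]
      exact mul_pos (ht a ha) (mul_self_pos.2 h0)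

/-- Every functional takes the same value on both combinations, and its sign can be read off at
either top. Applied in both directions, this puts the two tops in one cell. -/
theorem below_of_top {A : List (V →ᵃ[ℝ] ℝ)} {σ σ' : Finset V} {t t' : V → ℝ}
    (ht : ∀ p ∈ σ, 0 < t p) (ht' : ∀ p ∈ σ', 0 < t' p)
    (hsum : ∑ p ∈ σ, t p • p = ∑ p ∈ σ', t' p • p) (hmass : ∑ p ∈ σ, t p = ∑ p ∈ σ', t' p)
    {a a' : V} (ha : a ∈ σ) (htop : ∀ p ∈ σ, Below A p a)
    (ha' : a' ∈ σ') (htop' : ∀ p ∈ σ', Below A p a') : Below A a a' := by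
  intro f hf
  have e : ∑ p ∈ σ, t p * f p = ∑ p ∈ σ', t' p * f p := by
    rw [sum_mul_apply, sum_mul_apply, hsum, hmass]
  rcases sum_mul_apply_top ht ha htop hf with h | h
  · exact Or.inl h.1
  rcases sum_mul_apply_top ht' ha' htop' hf with h' | h'
  · rw [e, h'.2] at h
    simp at h
  · right
    rw [e] at h
    set F := ∑ p ∈ σ', t' p * f p
    have h3 : 0 < (f a * f a') * (F * F) := by nlinarith [mul_pos h h']
    exact pos_of_mul_pos_left h3 (mul_self_nonneg _)

/-- A point has at most one representation as a positive combination of a flag. -/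
theorem flag_combination_unique (A : List (V →ᵃ[ℝ] ℝ)) (n : ℕ) (σ σ' : Finset V) (t t' : V → ℝ)
    (hn : σ.card + σ'.card ≤ n)
    (hσ : σ.Nonempty → IsFlag A σ) (hσ' : σ'.Nonempty → IsFlag A σ')
    (ht : ∀ p ∈ σ, 0 < t p) (ht' : ∀ p ∈ σ', 0 < t' p)
    (hsum : ∑ p ∈ σ, t p • p = ∑ p ∈ σ', t' p • p) (hmass : ∑ p ∈ σ, t p = ∑ p ∈ σ', t' p) :
    σ = σ' ∧ ∀ p ∈ σ, t p = t' p := by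
  classical
  induction n generalizing σ σ' t t' with
  | zero =>
    have h1 : σ = ∅ := Finset.card_eq_zero.1 (by omega)
    have h2 : σ' = ∅ := Finset.card_eq_zero.1 (by omega)
    simp [h1, h2]
  | succ n ih =>
    -- Flags are nonempty, but removing tops may exhaust them; an empty set has mass 0 and can only
    -- match an empty set.
    rcases σ.eq_empty_or_nonempty with rfl | hne
    · rcases σ'.eq_empty_or_nonempty with rfl | hne'
      · simp
      · have := Finset.sum_pos ht' hne'
        rw [← hmass] at this
        simp at this
    rcases σ'.eq_empty_or_nonempty with rfl | hne'
    · have := Finset.sum_pos ht hne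
      rw [hmass] at this
      simp at this
    obtain ⟨a, ha, htop⟩ := (hσ hne).exists_top
    obtain ⟨a', ha', htop'⟩ := (hσ' hne').exists_top
    have haa : a = a' := by
      rw [← (hσ hne).2.1 a ha, ← (hσ' hne').2.1 a' ha']
      exact center_eq_center (below_of_top ht ht' hsum hmass ha htop ha' htop')
        (below_of_top ht' ht hsum.symm hmass.symm ha' htop' ha htop)
    subst haa
    -- subtract the smaller of the two weights of the common top
    have key : ∀ (σ σ' : Finset V) (t t' : V → ℝ), σ.card + σ'.card ≤ n + 1 →
        (σ.Nonempty → IsFlag A σ) → (σ'.Nonempty → IsFlag A σ') →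
        (∀ p ∈ σ, 0 < t p) → (∀ p ∈ σ', 0 < t' p) →
        ∑ p ∈ σ, t p • p = ∑ p ∈ σ', t' p • p → ∑ p ∈ σ, t p = ∑ p ∈ σ', t' p →
        a ∈ σ → a ∈ σ' → ¬ t' a < t a := by
      intro σ σ' t t' hn hσ hσ' ht ht' hsum hmass ha ha' hlt
      have hu : ∀ p ∈ σ.erase a, Function.update t a (t a - t' a) p = t p := fun p hp =>
        Function.update_of_ne (Finset.ne_of_mem_erase hp) _ _
      -- Taking the weight `t' a` off both sides leaves `a` with positive weight on the first side
      -- only. The induction hypothesis equates the two vertex sets, a contradiction.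
      have := ih σ (σ'.erase a) (Function.update t a (t a - t' a)) t'
        (by rw [Finset.card_erase_of_mem ha']; have := Finset.card_pos.2 ⟨a, ha'⟩; omega)
        hσ (fun h => (hσ' ⟨a, ha'⟩).subset (Finset.erase_subset _ _) h)
        (fun p hp => by
          rcases eq_or_ne p a with rfl | h
          · simpa using hlt
          · rw [Function.update_of_ne h]; exact ht p hp)
        (fun p hp => ht' p (Finset.mem_of_mem_erase hp))
        (by
          rw [← Finset.add_sum_erase _ _ ha, ← Finset.add_sum_erase _ _ ha'] at hsum
          rw [← Finset.add_sum_erase _ _ ha, Finset.sum_congr rfl fun p hp => congrArg (· • p) (hu p hp),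
            Function.update_self, sub_smul,
            sub_add_eq_add_sub, hsum]
          abel)
        (by
          rw [← Finset.add_sum_erase _ _ ha, ← Finset.add_sum_erase _ _ ha'] at hmass
          rw [← Finset.add_sum_erase _ _ ha, Finset.sum_congr rfl hu, Function.update_self]
          linarith)
      rw [this.1] at ha
      exact Finset.notMem_erase a σ' ha
    have hta : t a = t' a := le_antisymm
      (not_lt.1 (key σ σ' t t' hn hσ hσ' ht ht' hsum hmass ha ha'))
      (not_lt.1 (key σ' σ t' t (by omega) hσ' hσ ht' ht hsum.symm hmass.symm ha' ha))
    obtain ⟨h1, h2⟩ := ih (σ.erase a) (σ'.erase a) t t'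
      (by
        rw [Finset.card_erase_of_mem ha']
        have := Finset.card_erase_le (s := σ) (a := a)
        have := Finset.card_pos.2 ⟨a, ha'⟩
        omega)
      (fun h => (hσ hne).subset (Finset.erase_subset _ _) h)
      (fun h => (hσ' hne').subset (Finset.erase_subset _ _) h)
      (fun p hp => ht p (Finset.mem_of_mem_erase hp))
      (fun p hp => ht' p (Finset.mem_of_mem_erase hp))
      (by
        rw [← Finset.add_sum_erase _ _ ha, ← Finset.add_sum_erase _ _ ha', hta] at hsum
        exact add_left_cancel hsum)
      (by
        rw [← Finset.add_sum_erase _ _ ha, ← Finset.add_sum_erase _ _ ha', hta] at hmass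
        exact add_left_cancel hmass)
    refine ⟨by rw [← Finset.insert_erase ha, h1, Finset.insert_erase ha'], fun p hp => ?_⟩
    rcases eq_or_ne p a with rfl | h
    · exact hta
    · exact h2 p (Finset.mem_erase.2 ⟨h, hp⟩)

/-- Two convex combinations of flags that give the same point have the same weights. -/
theorem flag_weights_unique {A : List (V →ᵃ[ℝ] ℝ)} {σ σ' : Finset V} {t t' : V → ℝ}
    (hσ : IsFlag A σ) (hσ' : IsFlag A σ') (ht : ∀ p ∈ σ, 0 ≤ t p) (ht' : ∀ p ∈ σ', 0 ≤ t' p)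
    (hsum : ∑ p ∈ σ, t p • p = ∑ p ∈ σ', t' p • p) (hmass : ∑ p ∈ σ, t p = ∑ p ∈ σ', t' p) :
    σ.filter (t · ≠ 0) = σ'.filter (t' · ≠ 0) ∧ ∀ p ∈ σ, t p ≠ 0 → t p = t' p := by
  have hs : ∀ (σ : Finset V) (t : V → ℝ), ∑ p ∈ σ.filter (t · ≠ 0), t p • p = ∑ p ∈ σ, t p • p :=
    fun σ t => Finset.sum_filter_of_ne fun p _ h h0 => h (by simp [h0])
  have hm : ∀ (σ : Finset V) (t : V → ℝ), ∑ p ∈ σ.filter (t · ≠ 0), t p = ∑ p ∈ σ, t p :=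
    fun σ t => Finset.sum_filter_of_ne fun p _ h h0 => h (by simp [h0])
  have := flag_combination_unique A _ (σ.filter (t · ≠ 0)) (σ'.filter (t' · ≠ 0)) t t' le_rfl
    (fun h => hσ.subset (Finset.filter_subset _ _) h)
    (fun h => hσ'.subset (Finset.filter_subset _ _) h)
    (fun p hp => by
      rw [Finset.mem_filter] at hp
      exact lt_of_le_of_ne (ht p hp.1) (Ne.symm hp.2))
    (fun p hp => by
      rw [Finset.mem_filter] at hp
      exact lt_of_le_of_ne (ht' p hp.1) (Ne.symm hp.2))
    (by rw [hs, hs, hsum]) (by rw [hm, hm, hmass])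
  exact ⟨this.1, fun p hp h => this.2 p (Finset.mem_filter.2 ⟨hp, h⟩)⟩

/-! ### Complexes of flags -/

/-- A common point has the same support in both simplices, so it lies in the hull of their shared
vertices. -/
theorem PLSC.isCompatible_of_flags {A : List (V →ᵃ[ℝ] ℝ)} {C : PLSC V}
    (hC : ∀ σ ∈ C.faces, IsFlag A σ) : C.IsCompatible := by
  classical
  intro σ hσ σ' hσ'
  have hsub : realizedSimplex σ ∩ realizedSimplex σ' ⊆ realizedSimplex (σ ∩ σ') := by
    rintro x ⟨hx, hx'⟩
    rw [realizedSimplex, Finset.mem_convexHull'] at hx hx'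
    obtain ⟨t, ht, ht1, rfl⟩ := hx
    obtain ⟨t', ht', ht1', e⟩ := hx'
    have h := (flag_weights_unique (hC σ hσ) (hC σ' hσ') ht ht' e.symm (ht1.trans ht1'.symm)).1
    have hz : ∀ p ∈ σ, p ∉ σ ∩ σ' → t p = 0 := by
      intro p hp hp'
      by_contra h0
      have : p ∈ σ.filter (t · ≠ 0) := Finset.mem_filter.2 ⟨hp, h0⟩
      rw [h] at this
      exact hp' (Finset.mem_inter.2 ⟨hp, (Finset.mem_filter.1 this).1⟩)
    rw [realizedSimplex, Finset.mem_convexHull']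
    refine ⟨t, fun p hp => ht p (Finset.mem_inter.1 hp).1, ?_, ?_⟩
    · rw [← ht1]
      exact Finset.sum_subset Finset.inter_subset_left hz
    · exact Finset.sum_subset Finset.inter_subset_left fun p hp hp' => by simp [hz p hp hp']
  rcases (σ ∩ σ').eq_empty_or_nonempty with h | h
  · right
    rw [h] at hsub
    simpa [realizedSimplex] using hsub
  · exact Or.inl ⟨σ ∩ σ', (C.isRelLowerSet_faces hσ).2 Finset.inter_subset_left h,
      Finset.inter_subset_left, Finset.inter_subset_right, hsub.antisymm
        (Set.subset_inter (convexHull_mono (by simp)) (convexHull_mono (by simp)))⟩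

/-! ### Topology of the geometric realization. -/

theorem PLSC.mem_vertices_of_mem {E : Type*} {C : PLSC E} {σ : Finset E} (hσ : σ ∈ C.faces) {p : E}
    (hp : p ∈ σ) : p ∈ C.vertices :=
  (C.mem_vertices_iff p).2
    ((C.isRelLowerSet_faces hσ).2 (Finset.singleton_subset_iff.2 hp) (by simp))

theorem PLSC.finite_faces {E : Type*} (C : PLSC E) : C.faces.Finite := by
  classical
  refine (C.vertices.toFinset.powerset : Finset (Finset E)).finite_toSet.subset fun σ hσ => ?_
  simp only [Finset.coe_powerset, Set.mem_preimage, Set.mem_powerset_iff]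
  intro p hp
  simpa using C.mem_vertices_of_mem hσ hp

instance PLSC.finite_vertices {E : Type*} (C : PLSC E) : Finite {p // p ∈ C.vertices} :=
  List.finite_toSet C.vertices

/-- It is a closed subset of a finite-dimensional cube; the support condition is closed because
there are finitely many faces. -/
theorem PLSC.Geom.compactSpace {E : Type*} (C : PLSC E) : CompactSpace C.Geom := by
  have := Fintype.ofFinite {p // p ∈ C.vertices}
  have hc : IsCompact {t : {p // p ∈ C.vertices} → ℝ |
      (∀ p, 0 ≤ t p) ∧ ∑ᶠ p, t p = 1 ∧ ∃ σ ∈ C.faces, ∀ p, t p ≠ 0 → p.1 ∈ σ} := by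
    simp only [finsum_eq_sum_of_fintype]
    refine (isCompact_univ_pi fun _ => isCompact_Icc (a := (0 : ℝ)) (b := 1)).of_isClosed_subset
      ?_ ?_
    · refine IsClosed.inter (s₁ := {t : {p // p ∈ C.vertices} → ℝ | ∀ p, 0 ≤ t p}) ?_
        (IsClosed.inter (s₁ := {t : {p // p ∈ C.vertices} → ℝ | ∑ p, t p = 1}) ?_ ?_)
      · simp only [Set.ofPred_forall]
        exact isClosed_iInter fun p => isClosed_le continuous_const (continuous_apply p)
      · exact isClosed_eq (by fun_prop) continuous_const
      · have : {t : {p // p ∈ C.vertices} → ℝ | ∃ σ ∈ C.faces, ∀ p, t p ≠ 0 → p.1 ∈ σ} =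
            ⋃ σ ∈ C.faces, ⋂ p, {t | t p ≠ 0 → p.1 ∈ σ} := by
          ext t; simp
        change IsClosed {t : {p // p ∈ C.vertices} → ℝ | ∃ σ ∈ C.faces, ∀ p, t p ≠ 0 → p.1 ∈ σ}
        rw [this]
        refine C.finite_faces.isClosed_biUnion fun σ _ => isClosed_iInter fun p => ?_
        by_cases hp : p.1 ∈ σ
        · simp [hp]
        · simpa [hp] using isClosed_eq (continuous_apply p) continuous_const
    · rintro t ⟨h0, h1, -⟩ p -
      exact ⟨h0 p, h1 ▸ Finset.single_le_sum (fun q _ => h0 q) (Finset.mem_univ p)⟩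
  exact isCompact_iff_compactSpace.1 hc

/-- A sum over the vertices of a complex, of terms that vanish off a face, is a sum over the
face. -/
theorem PLSC.finsum_eq_sum_face {E M : Type*} [AddCommMonoid M] {C : PLSC E} {σ : Finset E}
    (hσ : σ ∈ C.faces) (g : E → M) (hg : ∀ p ∈ C.vertices, p ∉ σ → g p = 0) :
    ∑ᶠ p : {p // p ∈ C.vertices}, g p.1 = ∑ p ∈ σ, g p := by
  rw [finsum_subtype_eq_finsum_cond (f := g) (fun p => p ∈ C.vertices)]
  refine finsum_mem_eq_sum_of_subset (s := {p | p ∈ C.vertices}) g ?_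
    fun p hp => C.mem_vertices_of_mem hσ hp
  rintro p ⟨hp, hp'⟩
  by_contra h
  exact hp' (hg p hp h)

theorem PLSC.realization_injective {A : List (V →ᵃ[ℝ] ℝ)} {C : PLSC V}
    (hC : ∀ σ ∈ C.faces, IsFlag A σ) : Function.Injective C.realization := by
  classical
  -- Coordinates are extended by zero to all of `V`, where the weights of `flag_weights_unique` are
  -- defined.
  have ext0 : ∀ t : C.Geom, ∃ u : V → ℝ, ∀ p, t.1 p = u p.1 := fun t =>
    ⟨fun p => if h : p ∈ C.vertices then t.1 ⟨p, h⟩ else 0, fun p => by simp [p.2]⟩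
  intro t t' e
  obtain ⟨u, hu⟩ := ext0 t
  obtain ⟨u', hu'⟩ := ext0 t'
  obtain ⟨h0, h1, σ, hσ, hs⟩ := t.2
  obtain ⟨h0', h1', σ', hσ', hs'⟩ := t'.2
  simp only [PLSC.realization] at e
  simp only [hu] at h0 h1 hs e
  simp only [hu'] at h0' h1' hs' e
  have hv : ∀ p ∈ C.vertices, p ∉ σ → u p = 0 := fun p hp h => by
    by_contra h'; exact h (hs ⟨p, hp⟩ h')
  have hv' : ∀ p ∈ C.vertices, p ∉ σ' → u' p = 0 := fun p hp h => by
    by_contra h'; exact h (hs' ⟨p, hp⟩ h')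
  rw [PLSC.finsum_eq_sum_face hσ (fun p => u p • p) fun p hp h => by simp [hv p hp h],
    PLSC.finsum_eq_sum_face hσ' (fun p => u' p • p) fun p hp h => by simp [hv' p hp h]] at e
  rw [PLSC.finsum_eq_sum_face hσ u hv] at h1
  rw [PLSC.finsum_eq_sum_face hσ' u' hv'] at h1'
  obtain ⟨k1, k2⟩ := flag_weights_unique (hC σ hσ) (hC σ' hσ')
    (fun p hp => h0 ⟨p, C.mem_vertices_of_mem hσ hp⟩)
    (fun p hp => h0' ⟨p, C.mem_vertices_of_mem hσ' hp⟩) e (h1.trans h1'.symm)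
  refine Subtype.ext (funext fun p => ?_)
  rw [hu, hu']
  by_cases hp : u p.1 = 0
  · rw [hp]
    by_contra h
    have : p.1 ∈ σ'.filter (u' · ≠ 0) := Finset.mem_filter.2 ⟨hs' p (Ne.symm h), Ne.symm h⟩
    rw [← k1] at this
    exact (Finset.mem_filter.1 this).2 hp
  · exact k2 p.1 (hs p hp) hp

/-- A continuous injection from a compact space into a Hausdorff space is a closed embedding. -/
theorem PLSC.isEmbedding_realization_of_flags [TopologicalSpace V] [IsTopologicalAddGroup V]
    [ContinuousSMul ℝ V] [T2Space V] {A : List (V →ᵃ[ℝ] ℝ)} {C : PLSC V}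
    (hC : ∀ σ ∈ C.faces, IsFlag A σ) : Topology.IsEmbedding C.realization := by
  have := PLSC.Geom.compactSpace C
  have := Fintype.ofFinite {p // p ∈ C.vertices}
  refine (Continuous.isClosedEmbedding ?_ (PLSC.realization_injective hC)).isEmbedding
  unfold PLSC.realization
  simp only [finsum_eq_sum_of_fintype]
  refine continuous_finsetSum _ fun p _ => ?_
  exact ((continuous_apply p).comp continuous_subtype_val).smul continuous_const

/-! ### Subdividing segments and triangles -/

theorem wbtw_lineMap_of_le (x y : V) {s t : ℝ} (hs : 0 ≤ s) (hst : s ≤ t) :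
    Wbtw ℝ x (AffineMap.lineMap x y s) (AffineMap.lineMap x y t) := by
  have h : Wbtw ℝ 0 s t := by
    rw [← mem_segment_iff_wbtw, segment_eq_Icc (hs.trans hst)]
    exact ⟨hs, hst⟩
  simpa using h.map (AffineMap.lineMap x y : ℝ →ᵃ[ℝ] V)

theorem wbtw_or_wbtw {x y m z : V} (hm : Wbtw ℝ x m y) (hz : Wbtw ℝ x z y) :
    Wbtw ℝ x m z ∨ Wbtw ℝ x z m := by
  obtain ⟨s, hs, rfl⟩ := hm
  obtain ⟨t, ht, rfl⟩ := hz
  rcases le_total s t with h | h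
  · exact Or.inl (wbtw_lineMap_of_le x y hs.1 h)
  · exact Or.inr (wbtw_lineMap_of_le x y ht.1 h)

theorem exists_apply_of_wbtw {x m y : V} (h : Wbtw ℝ x m y) :
    ∃ t : ℝ, 0 ≤ t ∧ t ≤ 1 ∧ ∀ f : V →ᵃ[ℝ] ℝ, f m = (1 - t) * f x + t * f y := by
  obtain ⟨t, ht, rfl⟩ := h
  refine ⟨t, ht.1, ht.2, fun f => ?_⟩
  rw [AffineMap.apply_lineMap, AffineMap.lineMap_apply_module]
  simp

theorem apply_midpoint (f : V →ᵃ[ℝ] ℝ) (x y : V) : f (midpoint ℝ x y) = (f x + f y) / 2 := by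
  rw [AffineMap.map_midpoint, midpoint_eq_smul_add]
  simp
  ring

theorem exists_wbtw_apply_eq_zero (f : V →ᵃ[ℝ] ℝ) {x y : V} (h : f x * f y < 0) :
    ∃ m, Wbtw ℝ x m y ∧ f m = 0 := by
  have hne : f x - f y ≠ 0 := by
    intro h0
    rw [sub_eq_zero.1 h0] at h
    nlinarith [mul_self_nonneg (f y)]
  -- The parameter is the zero of `s ↦ (1 - s) * f x + s * f y`.
  refine ⟨AffineMap.lineMap x y (f x / (f x - f y)), ⟨_, ?_, rfl⟩, ?_⟩
  · rcases mul_neg_iff.1 h with ⟨h1, h2⟩ | ⟨h1, h2⟩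
    · exact ⟨by apply div_nonneg <;> linarith, by rw [div_le_one (by linarith)]; linarith⟩
    · exact ⟨div_nonneg_of_nonpos (by linarith) (by linarith),
        by rw [div_le_one_of_neg (by linarith)]; linarith⟩
  · rw [AffineMap.apply_lineMap, AffineMap.lineMap_apply_module]
    simp only [smul_eq_mul]
    field_simp
    ring

/-- A functional does not take opposite signs at any two of three points. -/
def NotCutBy (f : V →ᵃ[ℝ] ℝ) (x y z : V) : Prop :=
  0 ≤ f x * f y ∧ 0 ≤ f y * f z ∧ 0 ≤ f z * f x

theorem NotCutBy.rotate {f : V →ᵃ[ℝ] ℝ} {x y z : V} (h : NotCutBy f x y z) :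
    NotCutBy f y z x := ⟨h.2.1, h.2.2, h.1⟩

theorem mul_combo_nonneg {a b c t : ℝ} (h0 : 0 ≤ t) (h1 : t ≤ 1) (hb : 0 ≤ a * b)
    (hc : 0 ≤ a * c) : 0 ≤ a * ((1 - t) * b + t * c) := by
  have e : a * ((1 - t) * b + t * c) = (1 - t) * (a * b) + t * (a * c) := by ring
  rw [e]
  exact add_nonneg (mul_nonneg (by linarith) hb) (mul_nonneg h0 hc)

theorem NotCutBy.left {f : V →ᵃ[ℝ] ℝ} {x y z m : V} (h : NotCutBy f x y z)
    (hm : Wbtw ℝ y m z) : NotCutBy f x y m := by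
  obtain ⟨t, h0, h1, e⟩ := exists_apply_of_wbtw hm
  refine ⟨h.1, ?_, ?_⟩
  · rw [e]; exact mul_combo_nonneg h0 h1 (mul_self_nonneg _) h.2.1
  · rw [e, mul_comm]
    exact mul_combo_nonneg h0 h1 h.1 (by rw [mul_comm]; exact h.2.2)

theorem NotCutBy.right {f : V →ᵃ[ℝ] ℝ} {x y z m : V} (h : NotCutBy f x y z)
    (hm : Wbtw ℝ y m z) : NotCutBy f x m z := by
  obtain ⟨t, h0, h1, e⟩ := exists_apply_of_wbtw hm
  refine ⟨?_, ?_, h.2.2⟩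
  · rw [e]; exact mul_combo_nonneg h0 h1 h.1 (by rw [mul_comm]; exact h.2.2)
  · rw [e, mul_comm]
    exact mul_combo_nonneg h0 h1 (by rw [mul_comm]; exact h.2.1) (mul_self_nonneg _)

/-- A nonzero value at `x` keeps its sign when averaged with a value that is not of opposite sign.
-/
theorem below_midpoint {A : List (V →ᵃ[ℝ] ℝ)} {x y : V} (h : ∀ f ∈ A, 0 ≤ f x * f y) :
    Below A x (midpoint ℝ x y) := fun f hf => by
  rcases eq_or_ne (f x) 0 with h0 | h0
  · exact Or.inl h0
  · right
    rw [apply_midpoint]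
    nlinarith [h f hf, mul_self_pos.2 h0]

theorem below_midpoint_right {A : List (V →ᵃ[ℝ] ℝ)} {x y : V} (h : ∀ f ∈ A, 0 ≤ f x * f y) :
    Below A y (midpoint ℝ x y) := by
  rw [midpoint_comm]
  exact below_midpoint fun f hf => by rw [mul_comm]; exact h f hf

theorem midpoint_below {A : List (V →ᵃ[ℝ] ℝ)} {x y n : V} (hx : Below A x n)
    (hy : Below A y n) : Below A (midpoint ℝ x y) n := fun f hf => by
  rw [apply_midpoint]
  rcases hx f hf with h1 | h1 <;> rcases hy f hf with h2 | h2
  · exact Or.inl (by simp [h1, h2])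
  · exact Or.inr (by rw [h1]; nlinarith)
  · exact Or.inr (by rw [h2]; nlinarith)
  · exact Or.inr (by nlinarith)

theorem Below.mul_nonneg_of_below {A : List (V →ᵃ[ℝ] ℝ)} {x y n : V} (hx : Below A x n)
    (hy : Below A y n) : ∀ f ∈ A, 0 ≤ f x * f y := fun f hf => by
  rcases hx f hf with h1 | h1
  · simp [h1]
  rcases hy f hf with h2 | h2
  · simp [h2]
  have h3 : 0 < (f x * f y) * (f n * f n) := by nlinarith [mul_pos h1 h2]
  exact (pos_of_mul_pos_left h3 (mul_self_nonneg _)).le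

section Triangle

variable {A : List (V →ᵃ[ℝ] ℝ)} {T : V → V → V → Prop}
  (rot : ∀ x y z, T y z x → T x y z)
  (cut : ∀ x y m z, Wbtw ℝ y m z → T x y m → T x m z → T x y z)
  (base : ∀ x y z, Comparable A x y → Comparable A y z → Comparable A z x → T x y z)

include rot cut base

/-- Here `x` and `y` need not be comparable. Their midpoint is above both and below `n`, so joining
it to `n` leaves two triangles with pairwise comparable vertices. -/
theorem triangle_of_below {x y n : V} (hx : Below A x n) (hy : Below A y n) : T x y n := by
  have h := hx.mul_nonneg_of_below hy
  have hk := midpoint_below hx hy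
  refine rot _ _ _ (rot _ _ _ (cut n x (midpoint ℝ x y) y (wbtw_midpoint ℝ x y) ?_ ?_))
  · exact base _ _ _ (Or.inr hx) (Or.inl (below_midpoint h)) (Or.inl hk)
  · exact base _ _ _ (Or.inr hk) (Or.inr (below_midpoint_right h)) (Or.inl hy)

/-- The midpoint `n` of the median from `x` is above `x`, `y`, `z` and the foot `m`. Cutting along
the median and then from `y` and `z` to `n` leaves four triangles with vertex `n`, each covered by
`base` or `triangle_of_below`. -/
theorem triangle_of_notCutBy {x y z : V} (h : ∀ f ∈ A, NotCutBy f x y z) : T x y z := by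
  have hyz := fun f hf => (h f hf).2.1
  set m := midpoint ℝ y z with hm
  have hym : Below A y m := below_midpoint hyz
  have hzm : Below A z m := below_midpoint_right hyz
  have hxm : ∀ f ∈ A, 0 ≤ f m * f x := fun f hf =>
    ((h f hf).left (wbtw_midpoint ℝ y z)).2.2
  set n := midpoint ℝ m x with hn
  have hmn : Below A m n := below_midpoint hxm
  have hxn : Below A x n := below_midpoint_right hxm
  have hw : Wbtw ℝ m n x := wbtw_midpoint ℝ m x
  refine cut x y m z (wbtw_midpoint ℝ y z) (rot _ _ _ (cut y m n x hw ?_ ?_))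
    (rot _ _ _ (rot _ _ _ (cut z x n m hw.symm ?_ ?_)))
  · exact base _ _ _ (Or.inl hym) (Or.inl hmn) (Or.inr (hym.trans hmn))
  · exact rot _ _ _ (rot _ _ _ (triangle_of_below rot cut base hxn (hym.trans hmn)))
  · exact triangle_of_below rot cut base (hzm.trans hmn) hxn
  · exact base _ _ _ (Or.inl (hzm.trans hmn)) (Or.inr hmn) (Or.inr hzm)

-- `G` collects functionals that already do not cut the triangle, a property inherited by the
-- pieces. If `f` changes sign along an edge, a cut at its zero gives two pieces with a vertex where
-- `f` vanishes; each of these needs at most one more cut, on the opposite edge.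
omit base in
theorem triangle_cut_by {G : (V →ᵃ[ℝ] ℝ) → Prop} (f : V →ᵃ[ℝ] ℝ)
    (h : ∀ x y z, (∀ g, G g → NotCutBy g x y z) → NotCutBy f x y z → T x y z)
    {x y z : V} (hG : ∀ g, G g → NotCutBy g x y z) : T x y z := by
  have h1 : ∀ x y z, (∀ g, G g → NotCutBy g x y z) → f x = 0 → T x y z := by
    intro x y z hG h0
    by_cases hyz : 0 ≤ f y * f z
    · exact h x y z hG ⟨by simp [h0], hyz, by simp [h0]⟩
    · obtain ⟨m, hm, hm0⟩ := exists_wbtw_apply_eq_zero f (not_le.1 hyz)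
      exact cut x y m z hm
        (h _ _ _ (fun g hg => (hG g hg).left hm) ⟨by simp [h0], by simp [hm0], by simp [h0]⟩)
        (h _ _ _ (fun g hg => (hG g hg).right hm) ⟨by simp [h0], by simp [hm0], by simp [h0]⟩)
  have h2 : ∀ x y z, (∀ g, G g → NotCutBy g x y z) → f y * f z < 0 → T x y z := by
    intro x y z hG h0
    obtain ⟨m, hm, hm0⟩ := exists_wbtw_apply_eq_zero f h0
    refine cut x y m z hm (rot _ _ _ (rot _ _ _ (h1 _ _ _ (fun g hg => ?_) hm0)))
      (rot _ _ _ (h1 _ _ _ (fun g hg => ?_) hm0))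
    · exact ((hG g hg).left hm).rotate.rotate
    · exact ((hG g hg).right hm).rotate
  by_cases a : f y * f z < 0
  · exact h2 _ _ _ hG a
  by_cases b : f z * f x < 0
  · exact rot _ _ _ (h2 _ _ _ (fun g hg => (hG g hg).rotate) b)
  by_cases c : f x * f y < 0
  · exact rot _ _ _ (rot _ _ _ (h2 _ _ _ (fun g hg => (hG g hg).rotate.rotate) c))
  exact h _ _ _ hG ⟨not_lt.1 c, not_lt.1 a, not_lt.1 b⟩

/-- A property of triangles that is invariant under rotation and under gluing two triangles
along an edge, and that holds for the triangles whose vertices lie in pairwise comparable cells,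
holds for all triangles. -/
theorem triangle_induction (x y z : V) : T x y z := by
  -- `L` holds the functionals that may still cut the triangle; they are dealt with one at a time.
  have key : ∀ L : List (V →ᵃ[ℝ] ℝ), ∀ x y z,
      (∀ f, (f ∈ A ∧ f ∉ L) → NotCutBy f x y z) → T x y z := by
    intro L
    induction L with
    | nil =>
      intro x y z h
      exact triangle_of_notCutBy rot cut base fun f hf => h f ⟨hf, by simp⟩
    | cons f L ih =>
      intro x y z h
      refine triangle_cut_by rot cut f (G := fun g => g ∈ A ∧ g ∉ f :: L) ?_ h
      intro x y z h hf
      refine ih x y z fun g hg => ?_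
      by_cases e : g = f
      · rw [e]; exact hf
      · exact h g ⟨hg.1, by simp [e, hg.2]⟩
  exact key A x y z fun f hf => absurd hf.1 hf.2

end Triangle

/-- A property of segments that is invariant under gluing, and that holds for the segments whose
endpoints lie in comparable cells, holds for all segments. -/
theorem segment_induction {A : List (V →ᵃ[ℝ] ℝ)} {T : V → V → Prop}
    (cut : ∀ x m y, Wbtw ℝ x m y → T x m → T m y → T x y)
    (base : ∀ x y, Comparable A x y → T x y) (x y : V) : T x y := by
  have key : ∀ L : List (V →ᵃ[ℝ] ℝ), ∀ x y,
      (∀ f, (f ∈ A ∧ f ∉ L) → 0 ≤ f x * f y) → T x y := by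
    intro L
    induction L with
    | nil =>
      intro x y h
      have h' : ∀ f ∈ A, 0 ≤ f x * f y := fun f hf => h f ⟨hf, by simp⟩
      exact cut x _ y (wbtw_midpoint ℝ x y) (base _ _ (Or.inl (below_midpoint h')))
        (base _ _ (Or.inr (below_midpoint_right h')))
    | cons f L ih =>
      intro x y h
      by_cases hf : 0 ≤ f x * f y
      · refine ih x y fun g hg => ?_
        by_cases e : g = f
        · rw [e]; exact hf
        · exact h g ⟨hg.1, by simp [e, hg.2]⟩
      · obtain ⟨m, hm, hm0⟩ := exists_wbtw_apply_eq_zero f (not_le.1 hf)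
        obtain ⟨t, h0, h1, e⟩ := exists_apply_of_wbtw hm
        refine cut x m y hm (ih _ _ fun g hg => ?_) (ih _ _ fun g hg => ?_)
        · by_cases e' : g = f
          · simp [e', hm0]
          · rw [e]
            exact mul_combo_nonneg h0 h1 (mul_self_nonneg _) (h g ⟨hg.1, by simp [e', hg.2]⟩)
        · by_cases e' : g = f
          · simp [e', hm0]
          · rw [e, mul_comm]
            refine mul_combo_nonneg h0 h1 ?_ (mul_self_nonneg _)
            rw [mul_comm]
            exact h g ⟨hg.1, by simp [e', hg.2]⟩
  exact key A x y fun f hf => absurd hf.1 hf.2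

/-! ### The image of a segment in the complex of flags -/

/-- The path with a single letter. -/
noncomputable def letter (v : V) : PL0 V := PL0.mk V (FreeMonoid.of v)

theorem letter_zero : letter (0 : V) = 1 := PL0.mk_zero

theorem letter_mul_letter {v w : V} (h : Dep v w) : letter v * letter w = letter (v + w) :=
  PL0.mk_add h

theorem letter_inv (v : V) : (letter v)⁻¹ = letter (-v) :=
  inv_eq_of_mul_eq_one_right (PL0.mk_mul_mk_neg v)

theorem endpoint_letter (v : V) : PL0.endpoint (letter v) = Multiplicative.ofAdd v := rfl

/-- The path `g` is the image of the segment from `x` to `y` under the simplicial approximation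
that moves each point to the center of its cell. -/
inductive IsImage (A : List (V →ᵃ[ℝ] ℝ)) : V → V → PL0 V → Prop
  | comparable {x y : V} (h : Comparable A x y) : IsImage A x y (letter (center A y - center A x))
  | glue {x m y : V} {g g' : PL0 V} (hm : Wbtw ℝ x m y) (h : IsImage A x m g)
      (h' : IsImage A m y g') : IsImage A x y (g * g')

theorem IsImage.exists (A : List (V →ᵃ[ℝ] ℝ)) (x y : V) : ∃ g, IsImage A x y g :=
  segment_induction (A := A) (T := fun x y => ∃ g, IsImage A x y g)
    (fun _ _ _ hm ⟨_, h⟩ ⟨_, h'⟩ => ⟨_, .glue hm h h'⟩) (fun _ _ h => ⟨_, .comparable h⟩) x y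

theorem IsImage.symm {A : List (V →ᵃ[ℝ] ℝ)} {x y : V} {g : PL0 V} (h : IsImage A x y g) :
    IsImage A y x g⁻¹ := by
  induction h with
  | comparable h =>
    rw [letter_inv, neg_sub]
    exact .comparable h.symm
  | glue hm _ _ ih ih' =>
    rw [mul_inv_rev]
    exact .glue hm.symm ih' ih

/-- An interior point of a segment whose initial point lies on a face of the cell of its
endpoint belongs to the latter cell. -/
theorem Below.wbtw {A : List (V →ᵃ[ℝ] ℝ)} {x m y : V} (h : Below A x y) (hm : Wbtw ℝ x m y) :
    m = x ∨ (Below A m y ∧ Below A y m) := by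
  by_cases hmx : m = x
  · exact Or.inl hmx
  right
  obtain ⟨t, ht, rfl⟩ := hm
  have ht0 : 0 < t := lt_of_le_of_ne ht.1 (by rintro rfl; simp at hmx)
  have ht1 := ht.2
  have e : ∀ f : V →ᵃ[ℝ] ℝ, f (AffineMap.lineMap x y t) = (1 - t) * f x + t * f y := fun f => by
    rw [AffineMap.apply_lineMap, AffineMap.lineMap_apply_module]; simp
  have key : ∀ f ∈ A, f y = 0 ∧ f (AffineMap.lineMap x y t) = 0 ∨
      0 < f (AffineMap.lineMap x y t) * f y := fun f hf => by
    rw [e]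
    rcases eq_or_ne (f y) 0 with h0 | h0
    · left
      rcases h f hf with h1 | h1
      · simp [h0, h1]
      · simp [h0] at h1
    · right
      have h2 := mul_self_pos.2 h0
      have h3 : 0 ≤ f x * f y := by
        rcases h f hf with h1 | h1
        · simp [h1]
        · exact h1.le
      have : ((1 - t) * f x + t * f y) * f y = (1 - t) * (f x * f y) + t * (f y * f y) := by ring
      rw [this]
      have := mul_pos ht0 h2
      have := mul_nonneg (sub_nonneg.2 ht1) h3
      linarith
  refine ⟨fun f hf => (key f hf).imp And.right id, fun f hf => (key f hf).imp And.left ?_⟩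
  intro h
  rwa [mul_comm]

/-- Either `m = x` or `m` is in the cell of `y`, so one of the two letters is zero. -/
theorem letter_center_mul_of_below {A : List (V →ᵃ[ℝ] ℝ)} {x m y : V} (h : Below A x y)
    (hm : Wbtw ℝ x m y) : Comparable A x m ∧ Comparable A m y ∧
      letter (center A m - center A x) * letter (center A y - center A m) =
        letter (center A y - center A x) := by
  rcases h.wbtw hm with rfl | ⟨h1, h2⟩
  · exact ⟨.refl A _, Or.inl h, by simp [letter_zero]⟩
  · refine ⟨Or.inl (h.trans h2), Or.inl h1, ?_⟩
    rw [center_eq_center h1 h2]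
    simp [letter_zero]

theorem letter_center_mul {A : List (V →ᵃ[ℝ] ℝ)} {x m y : V} (h : Comparable A x y)
    (hm : Wbtw ℝ x m y) : Comparable A x m ∧ Comparable A m y ∧
      letter (center A m - center A x) * letter (center A y - center A m) =
        letter (center A y - center A x) := by
  rcases h with h | h
  · exact letter_center_mul_of_below h hm
  · obtain ⟨h1, h2, h3⟩ := letter_center_mul_of_below h hm.symm
    refine ⟨h2.symm, h1.symm, ?_⟩
    rw [← inv_inj, mul_inv_rev, letter_inv, letter_inv, letter_inv]
    simpa using h3

/-- This replaces common refinements: two subdivisions of a segment are compared by splitting one at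
the gluing points of the other. -/
theorem IsImage.split {A : List (V →ᵃ[ℝ] ℝ)} {x y : V} {g : PL0 V} (h : IsImage A x y g)
    {m : V} (hm : Wbtw ℝ x m y) :
    ∃ a b, IsImage A x m a ∧ IsImage A m y b ∧ g = a * b := by
  induction h generalizing m with
  | comparable h =>
    obtain ⟨h1, h2, h3⟩ := letter_center_mul h hm
    exact ⟨_, _, .comparable h1, .comparable h2, h3.symm⟩
  | @glue x z y g g' hz h h' ih ih' =>
    rcases wbtw_or_wbtw hm hz with k | k
    · obtain ⟨a, b, ha, hb, rfl⟩ := ih k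
      exact ⟨a, b * g', ha, .glue (hz.trans_left_right k) hb h', mul_assoc _ _ _⟩
    · obtain ⟨a, b, ha, hb, rfl⟩ := ih' (hm.trans_left_right k)
      exact ⟨g * a, b, .glue k h ha, hb, (mul_assoc _ _ _).symm⟩

theorem IsImage.eq_letter {A : List (V →ᵃ[ℝ] ℝ)} {x y : V} {g : PL0 V} (h : IsImage A x y g)
    (hc : Comparable A x y) : g = letter (center A y - center A x) := by
  induction h with
  | comparable h => rfl
  | glue hm _ _ ih ih' =>
    obtain ⟨h1, h2, h3⟩ := letter_center_mul hc hm
    rw [ih h1, ih' h2, h3]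

theorem IsImage.unique {A : List (V →ᵃ[ℝ] ℝ)} {x y : V} {g k : PL0 V} (h : IsImage A x y g)
    (h' : IsImage A x y k) : g = k := by
  induction h generalizing k with
  | comparable h => exact (h'.eq_letter h).symm
  | glue hm _ _ ih ih' =>
    obtain ⟨a, b, ha, hb, rfl⟩ := h'.split hm
    rw [ih ha, ih' hb]

/-- The image of the segment from `x` to `y` under the simplicial approximation that moves each
point to the center of its cell. -/
noncomputable def image (A : List (V →ᵃ[ℝ] ℝ)) (x y : V) : PL0 V := (IsImage.exists A x y).choose

theorem isImage_image (A : List (V →ᵃ[ℝ] ℝ)) (x y : V) : IsImage A x y (image A x y) :=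
  (IsImage.exists A x y).choose_spec

theorem image_of_comparable {A : List (V →ᵃ[ℝ] ℝ)} {x y : V} (h : Comparable A x y) :
    image A x y = letter (center A y - center A x) := (isImage_image A x y).eq_letter h

theorem image_mul_image {A : List (V →ᵃ[ℝ] ℝ)} {x m y : V} (hm : Wbtw ℝ x m y) :
    image A x m * image A m y = image A x y :=
  (IsImage.glue hm (isImage_image A x m) (isImage_image A m y)).unique (isImage_image A x y)

theorem image_inv (A : List (V →ᵃ[ℝ] ℝ)) (x y : V) : (image A x y)⁻¹ = image A y x :=
  (isImage_image A x y).symm.unique (isImage_image A y x)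

theorem image_self (A : List (V →ᵃ[ℝ] ℝ)) (x : V) : image A x x = 1 := by
  rw [image_of_comparable (.refl A x), sub_self, letter_zero]

theorem IsImage.endpoint {A : List (V →ᵃ[ℝ] ℝ)} {x y : V} {g : PL0 V} (h : IsImage A x y g) :
    PL0.endpoint g = Multiplicative.ofAdd (center A y - center A x) := by
  induction h with
  | comparable h => rfl
  | glue hm _ _ ih ih' =>
    rw [map_mul, ih, ih', ← ofAdd_add]
    congr 1
    abel

/-! ### Arrangements that cut out given affine subspaces -/

/-- The affine subspace through `p` with direction `W` is a union of cells. -/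
def Resolves (A : List (V →ᵃ[ℝ] ℝ)) (p : V) (W : Submodule ℝ V) : Prop :=
  ∀ x y, x - p ∈ W → Below A y x → y - p ∈ W

theorem Resolves.center_sub_mem {A : List (V →ᵃ[ℝ] ℝ)} {p : V} {W : Submodule ℝ V}
    (h : Resolves A p W) {x : V} (hx : x - p ∈ W) : center A x - p ∈ W :=
  h x _ hx (center_below A x)

/-- For `W = ⊥` the point `p` is a cell by itself. -/
theorem Resolves.center_eq {A : List (V →ᵃ[ℝ] ℝ)} {p : V} (h : Resolves A p ⊥) :
    center A p = p := by
  simpa [sub_eq_zero] using h.center_sub_mem (x := p) (by simp)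

theorem sub_mem_of_wbtw {p x m y : V} {W : Submodule ℝ V} (hx : x - p ∈ W) (hy : y - p ∈ W)
    (hm : Wbtw ℝ x m y) : m - p ∈ W := by
  obtain ⟨t, -, rfl⟩ := hm
  have e : AffineMap.lineMap x y t - p = (1 - t) • (x - p) + t • (y - p) := by
    rw [AffineMap.lineMap_apply_module]; module
  rw [e]
  exact W.add_mem (W.smul_mem _ hx) (W.smul_mem _ hy)

/-- The property `P` holds for all sufficiently fine arrangements. -/
def ForFine (P : List (V →ᵃ[ℝ] ℝ) → Prop) : Prop := ∃ A₀, ∀ A, A₀ ⊆ A → P A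

theorem ForFine.and {P Q : List (V →ᵃ[ℝ] ℝ) → Prop} (hP : ForFine P) (hQ : ForFine Q) :
    ForFine fun A => P A ∧ Q A := by
  obtain ⟨A, hA⟩ := hP
  obtain ⟨B, hB⟩ := hQ
  exact ⟨A ++ B, fun C hC => ⟨hA C fun f hf => hC (List.mem_append_left _ hf),
    hB C fun f hf => hC (List.mem_append_right _ hf)⟩⟩

theorem ForFine.mono {P Q : List (V →ᵃ[ℝ] ℝ) → Prop} (hP : ForFine P) (h : ∀ A, P A → Q A) :
    ForFine Q := hP.imp fun _ hA B hB => h B (hA B hB)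

theorem ForFine.of_forall {P : List (V →ᵃ[ℝ] ℝ) → Prop} (h : ∀ A, P A) : ForFine P :=
  ⟨[], fun A _ => h A⟩

theorem forFine_resolves [FiniteDimensional ℝ V] (p : V) (W : Submodule ℝ V) :
    ForFine fun A => Resolves A p W := by
  classical
  let b := Module.finBasis ℝ (V ⧸ W)
  -- Coordinates on `V ⧸ W`, translated to vanish simultaneously exactly on the affine subspace; a
  -- functional that vanishes on a cell vanishes on its faces.
  let f : Fin (Module.finrank ℝ (V ⧸ W)) → V →ᵃ[ℝ] ℝ := fun i =>
    ((b.coord i).comp W.mkQ).toAffineMap + AffineMap.const ℝ V (-((b.coord i).comp W.mkQ p))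
  have hf : ∀ i x, f i x = b.coord i (W.mkQ (x - p)) := fun i x => by
    simp [f, sub_eq_add_neg]
  refine ⟨List.ofFn f, fun A hA x y hx hy => ?_⟩
  rw [← Submodule.Quotient.mk_eq_zero, ← Submodule.mkQ_apply] at hx ⊢
  refine b.ext_elem fun i => ?_
  have h := hy (f i) (hA (by simp [List.mem_ofFn]))
  rw [hf, hf, hx] at h
  simpa using h

/-! ### Paths in a subspace -/

/-- The subgroup of the paths with letters in `W`. -/
noncomputable def PL0.within (W : Submodule ℝ V) : Subgroup (PL0 V) := Subgroup.closure (letter '' (W : Set V))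

theorem letter_mem_within {W : Submodule ℝ V} {v : V} (h : v ∈ W) : letter v ∈ PL0.within W :=
  Subgroup.subset_closure ⟨v, h, rfl⟩

theorem mk_ofList_cons (v : V) (l : List V) :
    PL0.mk V (FreeMonoid.ofList (v :: l)) = letter v * PL0.mk V (FreeMonoid.ofList l) := by
  rw [FreeMonoid.ofList_cons, map_mul]
  rfl

theorem mk_ofList_append (l l' : List V) : PL0.mk V (FreeMonoid.ofList (l ++ l')) =
    PL0.mk V (FreeMonoid.ofList l) * PL0.mk V (FreeMonoid.ofList l') := by
  rw [FreeMonoid.ofList_append, map_mul]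

theorem endpoint_mk_ofList (l : List V) :
    PL0.endpoint (PL0.mk V (FreeMonoid.ofList l)) = Multiplicative.ofAdd l.sum := by
  induction l with
  | nil => simp
  | cons v l ih => rw [mk_ofList_cons, map_mul, ih, endpoint_letter, List.sum_cons, ofAdd_add]

theorem mk_ofList_mem_within {W : Submodule ℝ V} {l : List V} (h : ∀ v ∈ l, v ∈ W) :
    PL0.mk V (FreeMonoid.ofList l) ∈ PL0.within W := by
  induction l with
  | nil => simp
  | cons v l ih =>
    rw [mk_ofList_cons]
    exact mul_mem (letter_mem_within (h v (by simp))) (ih fun u hu => h u (by simp [hu]))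

theorem mem_of_mem_push {W : Submodule ℝ V} {v : V} (hv : v ∈ W) {l : List V}
    (hl : ∀ u ∈ l, u ∈ W) : ∀ u ∈ push v l, u ∈ W := by
  intro u hu
  cases l with
  | nil =>
    unfold push at hu
    split_ifs at hu
    · simp at hu
    · simp at hu; exact hu ▸ hv
  | cons w t =>
    have hw := hl w (by simp)
    have ht : ∀ u ∈ t, u ∈ W := fun u hu => hl u (by simp [hu])
    unfold push at hu
    simp only at hu
    split_ifs at hu
    · exact hl u hu
    · exact ht u hu
    · rcases List.mem_cons.1 hu with rfl | hu
      exacts [W.add_mem hv hw, ht u hu]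
    · rcases List.mem_cons.1 hu with rfl | hu
      exacts [hv, hl u hu]

theorem mem_of_mem_act {W : Submodule ℝ V} {x : PL0 V} (hx : x ∈ PL0.within W) :
    ∀ l : {l : List V // IsMinimalWord l}, (∀ u ∈ l.1, u ∈ W) →
      ∀ u ∈ (PL0.act x l).1, u ∈ W := by
  induction hx using Subgroup.closure_induction'' with
  | one => intro l hl; rwa [PL0.act_one]
  | mem x hx =>
    obtain ⟨v, hv, rfl⟩ := hx
    intro l hl
    rw [letter, PL0.act_of]
    exact mem_of_mem_push hv hl
  | inv_mem x hx =>
    obtain ⟨v, hv, rfl⟩ := hx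
    intro l hl
    rw [letter_inv, letter, PL0.act_of]
    exact mem_of_mem_push (W.neg_mem hv) hl
  | mul x y _ _ hx hy =>
    intro l hl
    rw [PL0.act_mul]
    exact hx _ (hy l hl)

theorem PL0.minimalWord_eq {x : PL0 V} {l : List V} (hl : IsMinimalWord l)
    (h : PL0.mk V (FreeMonoid.ofList l) = x) : x.minimalWord = l :=
  (PL0.existsUnique_minimal x).unique x.minimalWord_spec ⟨hl, h⟩

/-- The minimal word arises when `x` acts on the empty word, and `push` creates no letters outside
`W`. -/
theorem span_le_of_mem_within {W : Submodule ℝ V} {x : PL0 V} (hx : x ∈ PL0.within W) :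
    x.span ≤ W := by
  have h : x.minimalWord = (PL0.act x ⟨[], isMinimalWord_nil⟩).1 :=
    PL0.minimalWord_eq (PL0.act x _).2 (by rw [PL0.mk_act]; simp)
  refine Submodule.span_le.2 fun v hv => ?_
  rw [Set.mem_ofPred_eq, h] at hv
  exact mem_of_mem_act hx ⟨[], isMinimalWord_nil⟩ (by simp) v hv

theorem mem_within_span (x : PL0 V) : x ∈ PL0.within x.span := by
  have h := x.minimalWord_spec.2
  have := mk_ofList_mem_within (W := x.span) (l := x.minimalWord)
    fun v hv => Submodule.subset_span hv
  rwa [h] at this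

/-- A closed path with letters in a subspace of dimension at most two is a planar loop. -/
def PlanarLoop.ofWithin [FiniteDimensional ℝ V] {W : Submodule ℝ V}
    (hW : Module.finrank ℝ W ≤ 2) (x : PL0 V) (hx : x ∈ PL0.within W)
    (h : PL0.endpoint x = 1) : PlanarLoop V :=
  ⟨x, h, (Submodule.finrank_mono (span_le_of_mem_within hx)).trans hW⟩

/-- Gluing points lie on the segment, hence in the affine subspace, and so do the centers of their
cells. This keeps the loops of image triangles planar. -/
theorem IsImage.mem_within {A : List (V →ᵃ[ℝ] ℝ)} {p : V} {W : Submodule ℝ V}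
    (hA : Resolves A p W) {x y : V} {g : PL0 V} (h : IsImage A x y g) (hx : x - p ∈ W)
    (hy : y - p ∈ W) : g ∈ PL0.within W := by
  induction h with
  | @comparable x y h =>
    refine letter_mem_within ?_
    have := W.sub_mem (hA.center_sub_mem hy) (hA.center_sub_mem hx)
    rwa [sub_sub_sub_cancel_right] at this
  | glue hm _ _ ih ih' =>
    have := sub_mem_of_wbtw hx hy hm
    exact mul_mem (ih hx this) (ih' this hy)

/-- All centers involved lie on one line, so the letters are multiples of `u` and merge by the
addition relation. -/
theorem IsImage.eq_letter_of_line {A : List (V →ᵃ[ℝ] ℝ)} {p u : V}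
    (hA : Resolves A p (ℝ ∙ u)) {x y : V} {g : PL0 V} (h : IsImage A x y g) (hx : x - p ∈ ℝ ∙ u)
    (hy : y - p ∈ ℝ ∙ u) : g = letter (center A y - center A x) := by
  induction h with
  | comparable h => rfl
  | @glue x m y _ _ hm _ _ ih ih' =>
    have hm' := sub_mem_of_wbtw hx hy hm
    rw [ih hx hm', ih' hm' hy]
    obtain ⟨a, ha⟩ := Submodule.mem_span_singleton.1 (hA.center_sub_mem hx)
    obtain ⟨b, hb⟩ := Submodule.mem_span_singleton.1 (hA.center_sub_mem hy)
    obtain ⟨c, hc⟩ := Submodule.mem_span_singleton.1 (hA.center_sub_mem hm')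
    have e1 : center A m - center A x = (c - a) • u := by rw [sub_smul, ha, hc]; abel
    have e2 : center A y - center A m = (b - c) • u := by rw [sub_smul, hb, hc]; abel
    rw [letter_mul_letter (by rw [e1, e2]; exact dep_smul_smul _ _ _)]
    congr 1
    abel

/-- If the endpoints of a segment are cells and its line is a union of cells, then the segment is
its own image. -/
theorem image_add {A : List (V →ᵃ[ℝ] ℝ)} {p u : V} (hA : Resolves A p (ℝ ∙ u))
    (hp : Resolves A p ⊥) (hq : Resolves A (p + u) ⊥) : image A p (p + u) = letter u := by
  rw [(isImage_image A p (p + u)).eq_letter_of_line hA (by simp)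
    (by simp), hp.center_eq, hq.center_eq,
    add_sub_cancel_left]

/-! ### Edge paths in the complex of flags -/

open Classical in
/-- The word `l` describes an edge path in the complex of flags that starts at `p`. -/
def IsEdgePath (A : List (V →ᵃ[ℝ] ℝ)) : V → List V → Prop
  | p, [] => center A p = p
  | p, u :: l => IsFlag A {p, p + u} ∧ IsEdgePath A (p + u) l

theorem IsEdgePath.append {A : List (V →ᵃ[ℝ] ℝ)} {p : V} {l l' : List V}
    (h : IsEdgePath A p l) (h' : IsEdgePath A (p + l.sum) l') : IsEdgePath A p (l ++ l') := by
  induction l generalizing p with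
  | nil => simpa using h'
  | cons u l ih => exact ⟨h.1, ih h.2 (by simpa [add_assoc] using h')⟩

theorem IsEdgePath.center_eq {A : List (V →ᵃ[ℝ] ℝ)} {p : V} {l : List V}
    (h : IsEdgePath A p l) : ∀ q ∈ l.scanl (· + ·) p, center A q = q := by
  induction l generalizing p with
  | nil => simpa [IsEdgePath] using h
  | cons u l ih =>
    rw [List.scanl_cons]
    intro q hq
    rcases List.mem_cons.1 hq with rfl | hq
    · exact h.1.2.1 _ (by simp)
    · exact ih h.2 q hq

theorem IsEdgePath.isFlag {A : List (V →ᵃ[ℝ] ℝ)} {p : V} {l : List V} [DecidableEq V]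
    (h : IsEdgePath A p l) :
    ∀ q q', [q, q'] <:+: l.scanl (· + ·) p → IsFlag A {q, q'} := by
  intro q q' hq
  suffices (l.scanl (· + ·) p).IsChain (fun q q' => IsFlag A {q, q'}) from
    (List.isChain_pair (R := fun q q' => IsFlag A {q, q'})).1 (this.infix hq)
  clear hq q q'
  induction l generalizing p with
  | nil => simp
  | cons u l ih =>
    have h1 := ih h.2
    have h2 := h.1
    rw [List.scanl_cons]
    cases l with
    | nil =>
      simp only [List.scanl_nil] at h1 ⊢
      refine List.isChain_pair.2 ?_
      convert h2
    | cons w l =>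
      rw [List.scanl_cons] at h1 ⊢
      refine List.isChain_cons_cons.2 ⟨?_, h1⟩
      convert h2

theorem isFlag_center {A : List (V →ᵃ[ℝ] ℝ)} [DecidableEq V] {x y : V} (h : Comparable A x y) :
    IsFlag A {center A x, center A y} := by
  refine ⟨by simp, by simp [center_center], ?_⟩
  simp only [Finset.mem_insert, Finset.mem_singleton]
  rintro p (rfl | rfl) q (rfl | rfl)
  exacts [.refl A _, h.center, h.symm.center, .refl A _]

/-- An image is only a class in `PL0`; the tail of a marked kite requires a word whose partial sums
are vertices of the complex of flags. -/
theorem IsImage.exists_isEdgePath {A : List (V →ᵃ[ℝ] ℝ)} {x y : V} {g : PL0 V}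
    (h : IsImage A x y g) : ∃ l : List V, IsEdgePath A (center A x) l ∧
      center A x + l.sum = center A y ∧ PL0.mk V (FreeMonoid.ofList l) = g := by
  classical
  induction h with
  | @comparable x y h =>
    refine ⟨[center A y - center A x], ⟨?_, ?_⟩, by simp, rfl⟩
    · rw [add_sub_cancel]
      convert isFlag_center h
    · change center A _ = _
      rw [add_sub_cancel, center_center]
  | glue _ _ _ ih ih' =>
    obtain ⟨l, h1, h2, rfl⟩ := ih
    obtain ⟨l', h1', h2', rfl⟩ := ih'
    refine ⟨l ++ l', h1.append (by rwa [h2]), ?_, mk_ofList_append _ _⟩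
    rw [List.sum_append, ← add_assoc, h2, h2']

/-- Every path from `p` is the class of an edge path for all sufficiently fine arrangements. -/
theorem forFine_isEdgePath [FiniteDimensional ℝ V] (p : V) (l : List V) :
    ForFine fun A => ∃ l' : List V, IsEdgePath A p l' ∧ l'.sum = l.sum ∧
      PL0.mk V (FreeMonoid.ofList l') = PL0.mk V (FreeMonoid.ofList l) := by
  induction l generalizing p with
  | nil =>
    exact (forFine_resolves p ⊥).mono fun A hA => ⟨[], hA.center_eq, rfl, rfl⟩
  | cons u l ih =>
    -- Both endpoints become cells and the line of the edge a union of cells, so `image_add`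
    -- identifies the class of the edge path with the letter `u`.
    refine ((((forFine_resolves p ⊥).and (forFine_resolves p (ℝ ∙ u))).and
      (forFine_resolves (p + u) ⊥)).and (ih (p + u))).mono ?_
    rintro A ⟨⟨⟨h1, h2⟩, h3⟩, l', h4, h5, h6⟩
    obtain ⟨k, hk1, hk2, hk3⟩ := (isImage_image A p (p + u)).exists_isEdgePath
    rw [h1.center_eq] at hk1 hk2
    rw [h3.center_eq] at hk2
    refine ⟨k ++ l', hk1.append (by rwa [hk2]), ?_, ?_⟩
    · rw [List.sum_append, h5, add_left_cancel hk2, List.sum_cons]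
    · rw [mk_ofList_append, hk3, h6, image_add h2 h1 h3, mk_ofList_cons]

/-! ### Relations between kites -/

theorem PL1Pre.ofKite_mul_ofKite (w : PL0 V) {b₁ b₂ b : PlanarLoop V} (h : b.1 = b₁.1 * b₂.1) :
    PL1Pre.ofKite (w, b₁) * PL1Pre.ofKite (w, b₂) = PL1Pre.ofKite (w, b) :=
  (conGen (PL1PreRel V)).eq.2 (ConGen.Rel.of _ _ (.concat w w b₁ b₂ b (by simp [h])))

theorem PL1.ofKite_mul_ofKite (w : PL0 V) {b₁ b₂ b : PlanarLoop V} (h : b.1 = b₁.1 * b₂.1) :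
    PL1.ofKite (w, b₁) * PL1.ofKite (w, b₂) = PL1.ofKite (w, b) := by
  unfold PL1.ofKite
  rw [← PL1Pre.ofKite_mul_ofKite w h]
  rfl

theorem PL1.ofKite_eq_one (w : PL0 V) {b : PlanarLoop V} (h : b.1 = 1) :
    PL1.ofKite (w, b) = 1 := by
  have : PL1Pre.ofKite (w, b) = 1 :=
    (conGen (PL1PreRel V)).eq.2 (ConGen.Rel.of _ _ (.trivial w b h))
  unfold PL1.ofKite
  rw [this]
  rfl

theorem PL1.ofKite_conj (w x : PL0 V) {b b' : PlanarLoop V} (h : b'.1 = x * b.1 * x⁻¹) :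
    PL1.ofKite (w, b') = PL1.ofKite (w * x, b) := by
  have : PL1Pre.ofKite (w, b') = PL1Pre.ofKite (w * x, b) :=
    (conGen (PL1PreRel V)).eq.2 (ConGen.Rel.of _ _ (.conj w x b b' h))
  unfold PL1.ofKite
  rw [this]

/-- A property of surfaces that is multiplicative and holds for kites holds for all surfaces. -/
theorem PL1.induction_on [FiniteDimensional ℝ V] {P : PL1 V → Prop} (X : PL1 V)
    (kite : ∀ w b, P (PL1.ofKite (w, b))) (one : P 1) (mul : ∀ X Y, P X → P Y → P (X * Y)) :
    P X := by
  let φ : FreeGroup (Kite V) →* PL1 V :=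
    (conGen (PeifferRel V)).mk'.comp (conGen (PL1PreRel V)).mk'
  have hφ : Function.Surjective φ :=
    (Con.mk'_surjective (c := conGen (PeifferRel V))).comp
      (Con.mk'_surjective (c := conGen (PL1PreRel V)))
  obtain ⟨Y, rfl⟩ := hφ X
  induction Y using FreeGroup.induction_on with
  | C1 => rw [map_one]; exact one
  | of Y => exact kite Y.1 Y.2
  | inv_of Y _ =>
    -- The inverse of a kite is again a kite, with the inverse loop, so closure under products
    -- suffices; representatives contain no inverses.
    obtain ⟨w, b⟩ := Y
    have hb : PL0.endpoint b.1⁻¹ = 1 := by rw [map_inv, b.2.1, inv_one]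
    have h := PL1.ofKite_mul_ofKite w (b₁ := b)
      (b₂ := .ofWithin b.2.2 b.1⁻¹ (inv_mem (mem_within_span b.1)) hb)
      (b := ⟨1, map_one _, by
        have := span_le_of_mem_within (PL0.within (⊥ : Submodule ℝ V)).one_mem
        rw [le_bot_iff.1 this]; simp⟩) (mul_inv_cancel b.1).symm
    rw [PL1.ofKite_eq_one w (b := ⟨1, _⟩) rfl] at h
    have e : φ (FreeGroup.of (w, b))⁻¹ = PL1.ofKite _ :=
      (map_inv φ _).trans (inv_eq_of_mul_eq_one_right h)
    rw [e]
    exact kite _ _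
  | mul Y Z hY hZ => rw [map_mul]; exact mul _ _ hY hZ

/-! ### Surfaces carried by the complex of flags -/

/-- The surfaces that have a triangulated representative whose simplices are flags. -/
noncomputable def flagSurfaces (A : List (V →ᵃ[ℝ] ℝ)) : Submonoid (PL1 V) where
  carrier := {X | ∃ r : FreeMonoid (MarkedKite V), IsRepresentative r X ∧ IsTriangulated r ∧
    ∀ Y ∈ FreeMonoid.toList r, ∀ σ ∈ Y.complex.faces, IsFlag A σ}
  one_mem' := ⟨1, map_one _, by simp [IsTriangulated], by simp⟩
  mul_mem' := by
    rintro X Y ⟨r, h1, h2, h3⟩ ⟨s, k1, k2, k3⟩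
    refine ⟨r * s, ?_, fun Z hZ => ?_, fun Z hZ => ?_⟩
    · rw [IsRepresentative, map_mul, h1, k1]
    · rw [FreeMonoid.toList_mul, List.mem_append] at hZ
      exact hZ.elim (h2 Z) (k2 Z)
    · rw [FreeMonoid.toList_mul, List.mem_append] at hZ
      exact hZ.elim (h3 Z) (k3 Z)

theorem faces_associatedComplex (r : FreeMonoid (MarkedKite V)) {σ : Finset V}
    (h : σ ∈ (associatedComplex r).faces) : ∃ Y ∈ FreeMonoid.toList r, σ ∈ Y.complex.faces := by
  unfold associatedComplex at h
  generalize FreeMonoid.toList r = L at h ⊢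
  induction L with
  | nil => exact absurd h (Set.notMem_empty σ)
  | cons Y l ih =>
    rw [List.map_cons, List.foldr_cons] at h
    rcases h with h | h
    · exact ⟨Y, by simp, h⟩
    · obtain ⟨Z, hZ, hσ⟩ := ih h
      exact ⟨Z, by simp [hZ], hσ⟩

open Classical in
theorem isFlag_of_mem_kiteFaces {A : List (V →ᵃ[ℝ] ℝ)} {l : List V}
    (hl : IsEdgePath A 0 l) {r s : V} (hf : IsFlag A {l.sum, r, s}) {σ : Finset V}
    (hσ : σ ∈ kiteFaces (tailPoints l) l.sum r s) : IsFlag A σ := by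
  rcases hσ with (⟨p, hp, rfl⟩ | ⟨p, p', h, rfl⟩ | rfl | rfl | rfl) | rfl
  · refine ⟨by simp, ?_, by simpa using Comparable.refl A p⟩
    simp only [Finset.mem_singleton, forall_eq]
    rcases List.mem_append.1 hp with hp | hp
    · exact hl.center_eq p hp
    · exact hf.2.1 p (by simp at hp; grind)
  · exact hl.isFlag p p' h
  · exact hf.subset (by grind) (by simp)
  · exact hf.subset (by grind) (by simp)
  · exact hf.subset (by grind) (by simp)
  · exact hf

/-! ### Flag triangulations of kites and surfaces. -/

theorem isMinimalWord_triangle {a b c : V} (h : ¬ Dep a b) (hc : a + b + c = 0) :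
    IsMinimalWord [a, b, c] := by
  have e : c = -(a + b) := (neg_eq_of_add_eq_zero_right hc).symm
  -- If `c` were a multiple of `b`, then so would be `a = -b - c`.
  have hbc : ¬ Dep b c := by
    intro hd
    apply h
    have hb : b ≠ 0 := by
      rintro rfl
      exact h (by simpa using dep_smul_smul 1 0 a)
    rcases dep_iff.1 hd with h0 | ⟨t, ht⟩
    · exact absurd h0 hb
    · have : a = (-1 - t) • b := by
        rw [sub_smul, ← ht, e]; module
      rw [this]
      simpa using dep_smul_smul (-1 - t) 1 b
  refine isMinimalWord_cons_cons.2 ⟨h, isMinimalWord_cons_cons.2 ⟨hbc, isMinimalWord_singleton.2 ?_⟩⟩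
  rintro rfl
  exact hbc (by simpa using dep_smul_smul 1 0 b)

/-- A kite whose tail is an edge path and whose loop is the boundary of a triangle with vertices
in pairwise comparable cells is carried by the complex of flags. -/
theorem kite_mem_flagSurfaces_of_comparable {A : List (V →ᵃ[ℝ] ℝ)} {x y z : V}
    (hxy : Comparable A x y) (hyz : Comparable A y z) (hzx : Comparable A z x)
    {l : List V} (hl : IsEdgePath A 0 l) (hx : l.sum = center A x) {b : PlanarLoop V}
    (hb : b.1 = image A x y * image A y z * image A z x) :
    PL1.ofKite (PL0.mk V (FreeMonoid.ofList l), b) ∈ flagSurfaces A := by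
  classical
  rw [image_of_comparable hxy, image_of_comparable hyz, image_of_comparable hzx] at hb
  -- The loop of a degenerate triangle is trivial, so the empty word represents its kite.
  by_cases hd : Dep (center A y - center A x) (center A z - center A y)
  · rw [PL1.ofKite_eq_one]
    · exact one_mem _
    · have e : center A x - center A z =
          -(center A y - center A x + (center A z - center A y)) := by abel
      rw [hb, letter_mul_letter hd, e, ← letter_inv, mul_inv_cancel]
  · have hm := isMinimalWord_triangle hd (c := center A x - center A z) (by abel)
    have hw : b.1.minimalWord = _ := PL0.minimalWord_eq hm (by
      rw [hb, mk_ofList_cons, mk_ofList_cons, mk_ofList_cons, FreeMonoid.ofList_nil, map_one,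
        mul_one, mul_assoc])
    let Y₀ : MarkedKite V := (FreeMonoid.ofList l, b)
    refine ⟨FreeMonoid.of Y₀, ?_, ?_, ?_⟩
    · exact FreeMonoid.lift_eval_of _ _
    · intro Y hY
      rw [FreeMonoid.toList_of, List.mem_singleton] at hY
      subst hY
      exact ⟨_, _, _, hw⟩
    · intro Y hY σ hσ
      rw [FreeMonoid.toList_of, List.mem_singleton] at hY
      subst hY
      have hw' : Y₀.2.1.minimalWord = _ := hw
      unfold MarkedKite.complex at hσ
      simp only [hw'] at hσ
      refine isFlag_of_mem_kiteFaces hl ?_ hσ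
      have e1 : l.sum + (center A y - center A x) = center A y := by rw [hx]; abel
      have e2 : center A y + (center A z - center A y) = center A z := by abel
      change IsFlag A {l.sum, l.sum + (center A y - center A x),
        l.sum + (center A y - center A x) + (center A z - center A y)}
      rw [e1, e2, hx]
      refine ⟨by simp, by simp [center_center], ?_⟩
      simp only [Finset.mem_insert, Finset.mem_singleton]
      rintro p (rfl | rfl | rfl) q (rfl | rfl | rfl)
      exacts [.refl A _, hxy.center, hzx.symm.center, hxy.symm.center, .refl A _, hyz.center,
        hzx.center, hyz.symm.center, .refl A _]

/-- A kite whose tail is an edge path and whose loop is the image of the boundary of a triangle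
in a plane that is a union of cells is carried by the complex of flags. -/
theorem kite_mem_flagSurfaces_of_triangle [FiniteDimensional ℝ V] {A : List (V →ᵃ[ℝ] ℝ)} {p : V}
    {W : Submodule ℝ V} (hA : Resolves A p W) (hW : Module.finrank ℝ W ≤ 2) (x y z : V) :
    x - p ∈ W → y - p ∈ W → z - p ∈ W →
    ∀ l : List V, IsEdgePath A 0 l → l.sum = center A x → ∀ b : PlanarLoop V,
      b.1 = image A x y * image A y z * image A z x →
      PL1.ofKite (PL0.mk V (FreeMonoid.ofList l), b) ∈ flagSurfaces A := by
  have hwithin : ∀ {x y : V}, x - p ∈ W → y - p ∈ W → image A x y ∈ PL0.within W :=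
    fun {x y} hx hy => (isImage_image A x y).mem_within hA hx hy
  let loop : ∀ x y z : V, x - p ∈ W → y - p ∈ W → z - p ∈ W → PlanarLoop V := fun x y z hx hy hz =>
    .ofWithin hW (image A x y * image A y z * image A z x)
      (mul_mem (mul_mem (hwithin hx hy) (hwithin hy hz)) (hwithin hz hx)) (by
        rw [map_mul, map_mul, (isImage_image A x y).endpoint, (isImage_image A y z).endpoint,
          (isImage_image A z x).endpoint, ← ofAdd_add, ← ofAdd_add, ofAdd_eq_one]
        abel)
  refine triangle_induction (A := A) (T := fun x y z => x - p ∈ W → y - p ∈ W → z - p ∈ W →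
    ∀ l : List V, IsEdgePath A 0 l → l.sum = center A x → ∀ b : PlanarLoop V,
      b.1 = image A x y * image A y z * image A z x →
      PL1.ofKite (PL0.mk V (FreeMonoid.ofList l), b) ∈ flagSurfaces A) ?_ ?_ ?_ x y z
  · intro x y z h hx hy hz l hl hlx b hb
    -- Rotation moves the base point from `x` to `y`: the tail is prolonged by an edge path and the
    -- loop is conjugated. For this reason the property quantifies over all tails `l`.
    obtain ⟨k, hk1, hk2, hk3⟩ := (isImage_image A x y).exists_isEdgePath
    have := h hy hz hx (l ++ k) (hl.append (by rwa [zero_add, hlx]))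
      (by rw [List.sum_append, hlx, hk2]) (loop y z x hy hz hx) rfl
    rw [mk_ofList_append, hk3, ← PL1.ofKite_conj (b' := b)] at this
    · exact this
    · rw [hb]
      change _ = image A x y * (image A y z * image A z x * image A x y) * _
      group
  · intro x y m z hm h1 h2 hx hy hz l hl hlx b hb
    have hm' := sub_mem_of_wbtw hy hz hm
    -- The two passages along the cut from `x` to `m` cancel, so the loop is the product of the
    -- loops of the pieces.
    rw [← PL1.ofKite_mul_ofKite _ (b₁ := loop x y m hx hy hm') (b₂ := loop x m z hx hm' hz)]
    · exact mul_mem (h1 hx hy hm' l hl hlx _ rfl) (h2 hx hm' hz l hl hlx _ rfl)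
    · rw [hb, ← image_mul_image hm]
      change _ = image A x y * image A y m * image A m x *
        (image A x m * image A m z * image A z x)
      rw [← image_inv A x m]
      group
  · intro x y z hxy hyz hzx _ _ _ l hl hlx b hb
    exact kite_mem_flagSurfaces_of_comparable hxy hyz hzx hl hlx hb

/-- The fan triangulation of a planar loop. -/
theorem forFine_kite_mem_flagSurfaces [FiniteDimensional ℝ V] {p : V} {W : Submodule ℝ V}
    (hW : Module.finrank ℝ W ≤ 2) (bl : List V) (hbl : ∀ v ∈ bl, v ∈ W) (q : V)
    (hq : q - p ∈ W) : ForFine fun A => ∀ l : List V, IsEdgePath A 0 l → l.sum = p →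
      ∀ b : PlanarLoop V, b.1 = image A p q * PL0.mk V (FreeMonoid.ofList bl) *
        image A (q + bl.sum) p →
      PL1.ofKite (PL0.mk V (FreeMonoid.ofList l), b) ∈ flagSurfaces A := by
  induction bl generalizing q with
  | nil =>
    refine .of_forall fun A l _ _ b hb => ?_
    rw [PL1.ofKite_eq_one]
    · exact one_mem _
    · rw [hb, ← image_inv A p]
      simp
  | cons u bl ih =>
    -- The point `q` is the current position on the loop, joined to the apex `p` by a spoke. The
    -- triangle `p, q, q + u` is split off by going along the spoke from `q + u` to `p` and back.
    have hu : u ∈ W := hbl u (by simp)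
    have hq' : q + u - p ∈ W := by
      rw [add_sub_right_comm]; exact W.add_mem hq hu
    refine (((forFine_resolves p W).and (forFine_resolves p ⊥)).and
      (((forFine_resolves q ⊥).and (forFine_resolves (q + u) ⊥)).and
      ((forFine_resolves q (ℝ ∙ u)).and (ih (fun v hv => hbl v (by simp [hv])) (q + u) hq')))).mono ?_
    rintro A ⟨⟨hA, hp⟩, ⟨h1, h2⟩, h3, h4⟩ l hl hlp b hb
    have hpp : p - p ∈ W := by simp
    have hi : ∀ {x y : V}, x - p ∈ W → y - p ∈ W → image A x y ∈ PL0.within W :=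
      fun {x y} hx hy => (isImage_image A x y).mem_within hA hx hy
    have hend : q + u + bl.sum - p ∈ W := by
      rw [add_sub_right_comm]
      exact W.add_mem hq' (list_sum_mem fun v hv => hbl v (by simp [hv]))
    let b₁ : PlanarLoop V := .ofWithin hW (image A p q * image A q (q + u) * image A (q + u) p)
      (mul_mem (mul_mem (hi hpp hq) (hi hq hq')) (hi hq' hpp)) (by
        rw [map_mul, map_mul, (isImage_image A _ _).endpoint, (isImage_image A _ _).endpoint,
          (isImage_image A _ _).endpoint, ← ofAdd_add, ← ofAdd_add, ofAdd_eq_one]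
        abel)
    have e : b.1 = b₁.1 * (image A p (q + u) * PL0.mk V (FreeMonoid.ofList bl) *
        image A (q + u + bl.sum) p) := by
      rw [hb, mk_ofList_cons, ← image_add h3 h1 h2, List.sum_cons, ← add_assoc]
      change _ = image A p q * image A q (q + u) * image A (q + u) p * _
      rw [← image_inv A p (q + u)]
      group
    -- The remaining loop is closed because `b` and `b₁` are.
    let b₂ : PlanarLoop V := .ofWithin hW (image A p (q + u) * PL0.mk V (FreeMonoid.ofList bl) *
        image A (q + u + bl.sum) p)
      (mul_mem (mul_mem (hi hpp hq') (mk_ofList_mem_within fun v hv => hbl v (by simp [hv])))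
        (hi hend hpp)) (by
        have := congrArg PL0.endpoint e
        rw [map_mul, b.2.1, b₁.2.1, one_mul] at this
        exact this.symm)
    rw [← PL1.ofKite_mul_ofKite _ (b₁ := b₁) (b₂ := b₂) e]
    refine mul_mem ?_ (h4 l hl hlp b₂ rfl)
    exact kite_mem_flagSurfaces_of_triangle hA hW p q (q + u) hpp hq hq' l hl
      (by rw [hp.center_eq, hlp]) b₁ rfl

/-- Every surface is carried by the complex of flags of all sufficiently fine arrangements. -/
theorem forFine_mem_flagSurfaces [FiniteDimensional ℝ V] (X : PL1 V) :
    ForFine fun A => X ∈ flagSurfaces A := by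
  induction X using PL1.induction_on with
  | kite w b =>
    obtain ⟨l, rfl⟩ : ∃ l : List V, PL0.mk V (FreeMonoid.ofList l) = w :=
      ⟨_, w.minimalWord_spec.2⟩
    have hb := b.1.minimalWord_spec.2
    have hsum : b.1.minimalWord.sum = 0 := by
      have := b.2.1
      rw [← hb, endpoint_mk_ofList, ofAdd_eq_one] at this
      exact this
    refine ((forFine_isEdgePath 0 l).and (forFine_kite_mem_flagSurfaces b.2.2 b.1.minimalWord
      (fun v hv => Submodule.subset_span hv) l.sum (p := l.sum) (by simp))).mono ?_
    rintro A ⟨⟨k, h1, h2, h3⟩, h⟩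
    rw [← h3]
    -- The fan starts at its apex and the loop is closed, so both outer spokes are trivial and the
    -- fan yields `b` itself.
    exact h k h1 h2 b (by rw [hsum, hb, add_zero, image_self, one_mul, mul_one])
  | one => exact .of_forall fun A => one_mem _
  | mul X Y hX hY => exact (hX.and hY).mono fun A h => mul_mem h.1 h.2

end PLSurface

theorem mainTheorem11 {V : Type*} [AddCommGroup V] [Module ℝ V] [FiniteDimensional ℝ V]
    [TopologicalSpace V] [IsTopologicalAddGroup V] [ContinuousSMul ℝ V] [T2Space V]
    (X : PLSurface.PL1 V) :
    ∃ r : FreeMonoid (PLSurface.MarkedKite V),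
      PLSurface.IsRepresentative r X ∧ PLSurface.IsTriangulated r ∧
      (PLSurface.associatedComplex r).IsCompatible ∧
      Topology.IsEmbedding (PLSurface.associatedComplex r).realization := by
  obtain ⟨A, hA⟩ := PLSurface.forFine_mem_flagSurfaces X
  obtain ⟨r, hr, ht, hf⟩ := hA A (List.Subset.refl A)
  have h : ∀ σ ∈ (PLSurface.associatedComplex r).faces, PLSurface.IsFlag A σ := fun σ hσ =>
    have ⟨Y, hY, hσY⟩ := PLSurface.faces_associatedComplex r hσ
    hf Y hY σ hσY
  exact ⟨r, hr, ht, PLSurface.PLSC.isCompatible_of_flags h,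
    PLSurface.PLSC.isEmbedding_realization_of_flags h⟩
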